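/- Let $0<\beta_L\le\beta_R$, $T_L=1/\beta_L$, $T_R=1/\beta_R$, and consider a particle in $[0,1]$ moving freely between two thermal walls, at $0$ (left) and $1$ (right). Its initial position and velocity are $q_0\in[0,1]$ and $p_0\neq 0$. Put $\sigma_0=\operatorname{sign}(p_0)$ and $\sigma_k=(-1)^k\sigma_0$; the first collision occurs at time $S_0=\big(\tfrac{\sigma_0+1}{2}-q_0\big)/p_0$ and the later ones at times $S_k=S_0+\tau_1+\dots+\tau_k$, $k\ge 1$, where $\tau_1,\tau_2,\dots$ are independent and $1/\tau_k$ has the law $\beta\,p\,e^{-\beta p^2/2}\mathbf 1_{\{p>0\}}\,dp$ with $\beta=\beta_L$ if $\sigma_{k-1}=-1$ and $\beta=\beta_R$ if $\sigma_{k-1}=1$. With $v_k=\sigma_k/\tau_k$, the energy exchanged between the walls during $[0,t]$ is $$J[0,t]=\frac12\sum_{k\ge 1:\,S_k\le t}v_k^2\,\sigma_k .$$ For $\lambda\in\mathbb R$ let $$f(\lambda)=\lim_{t\to+\infty}\frac1t\log\mathbb E\big(e^{\lambda J[0,t]}\big)\in[-\infty,+\infty],\qquad I(j)=\sup_{\lambda\in\mathbb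 R}\{\lambda j-f(\lambda)\},\quad j\in\mathbb R,$$ and let $j^*=\kappa(T_L-T_R)$ with $\kappa^{-1}=\sqrt{\pi\beta_L/2}+\sqrt{\pi\beta_R/2}$. Then the limit $f(\lambda)$ exists for every $\lambda\in\mathbb R$ and does not depend on $(q_0,p_0)$, and the function $I$ is finite, nonnegative and convex on $\mathbb R$. Moreover: 1. $I$ is $C^\infty$ on $\mathbb R\setminus[-j^*,j^*]$ and strictly convex there: $I(ax+by)<aI(x)+bI(y)$ for all distinct $x,y\in\mathbb R\setminus[-j^*,j^*]$ and all $a,b>0$ with $a+b=1$; 2. $I(j)=0$ for all $j\in[0,j^*]$; 3. $I(j)=(\beta_R-\beta_L)|j|$ for all $j\in[-j^*,0]$; 4. $I(j)=(\beta_L-\beta_R)\,j+I(-j)$ for all $j\in\mathbb R$. -/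

import Mathlib

open MeasureTheory Filter Topology

namespace ConfinedTracer

noncomputable section

/-- Density on `ℝ` of the law `φ_β(dp) = β p e^{-β p²/2} 1_{p>0} dp` of the speed with which a wall
of inverse temperature `β` re-emits the particle. -/
def wallDensity (β p : ℝ) : ℝ :=
  if 0 < p then β * p * Real.exp (-β * p ^ 2 / 2) else 0

/-- The law `φ_β` of the speed at emission from a wall of inverse temperature `β`. -/
def wallLaw (β : ℝ) : Measure ℝ :=
  volume.withDensity fun p => ENNReal.ofReal (wallDensity β p)

/-- The sign `σ_k = (-1)^k σ_0`, with `σ_0 = sign p₀`: the particle sits at the right wall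
(`σ_k = 1`) or at the left wall (`σ_k = -1`) at its `k`-th collision, collisions being numbered
from `k = 0`. -/
def wallSign (p₀ : ℝ) (k : ℕ) : ℝ := (-1) ^ k * Real.sign p₀

/-- Inverse temperature `β_σ` of the wall `σ`, with `β_{-1} = β_L` and `β_{1} = β_R`. -/
def wallBeta (βL βR σ : ℝ) : ℝ := if σ < 0 then βL else βR

/-- Law of the sequence of emission speeds: the speed `u k = 1 / τ_{k+1}` with which the particle
leaves the wall after its `k`-th collision has law `φ_{β_{σ_k}}`, and these speeds are
independent. -/
def speedLaw (βL βR p₀ : ℝ) : Measure (ℕ → ℝ) :=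
  Measure.infinitePi fun k => wallLaw (wallBeta βL βR (wallSign p₀ k))

/-- The time `S_k = S_0 + τ_1 + ⋯ + τ_k` of the `k`-th collision (`k ≥ 0`), where
`S_0 = (σ̂_0 - q₀) / p₀` with `σ̂_0 = (σ_0 + 1) / 2`, and `τ_{i+1} = 1 / u i` is the time needed
to cross `[0,1]` at speed `u i`. -/
def collisionTime (q₀ p₀ : ℝ) (u : ℕ → ℝ) (k : ℕ) : ℝ :=
  ((Real.sign p₀ + 1) / 2 - q₀) / p₀ + ∑ i ∈ Finset.range k, 1 / u i

open scoped Classical in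
/-- The energy `J[0,t] = (1/2) ∑_{k ≥ 1, S_k ≤ t} v_k² σ_k` exchanged between the walls during
`[0,t]`, where `v_k = σ_k / τ_k = σ_k * u (k-1)` is the velocity just before the `k`-th collision.
Almost surely the sum has finitely many nonzero terms. The index `n` below is `k - 1`. -/
def current (q₀ p₀ : ℝ) (u : ℕ → ℝ) (t : ℝ) : ℝ :=
  (1 / 2) * ∑' n : ℕ, if collisionTime q₀ p₀ u (n + 1) ≤ t then
    (wallSign p₀ (n + 1) * u n) ^ 2 * wallSign p₀ (n + 1) else 0

/-- `(1/t) log E(exp(λ J[0,t]))`, an extended real number. -/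
def scaledLogMgf (βL βR q₀ p₀ l t : ℝ) : EReal :=
  ((1 / t : ℝ) : EReal) * ENNReal.log
    (∫⁻ u, ENNReal.ofReal (Real.exp (l * current q₀ p₀ u t)) ∂(speedLaw βL βR p₀))

/-- The cumulant generating function `f(λ) = lim_{t → ∞} (1/t) log E(exp(λ J[0,t]))`, with values
in the extended reals. It is written as an upper limit, which is defined without further ado. -/
def cgf (βL βR q₀ p₀ l : ℝ) : EReal :=
  limsup (scaledLogMgf βL βR q₀ p₀ l) atTop

/-- The Legendre transform `I(j) = sup_{λ ∈ ℝ} (λ j - f(λ))`. -/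
def rateFunction (βL βR q₀ p₀ j : ℝ) : EReal :=
  ⨆ l : ℝ, (((l * j : ℝ) : EReal) - cgf βL βR q₀ p₀ l)

/-- The conductivity `κ`, given by `κ⁻¹ = (π β_L / 2)^{1/2} + (π β_R / 2)^{1/2}`. -/
def conductivity (βL βR : ℝ) : ℝ :=
  (Real.sqrt (Real.pi * βL / 2) + Real.sqrt (Real.pi * βR / 2))⁻¹

/-- `j* = κ (T_L - T_R)`, with `T_L = 1/β_L` and `T_R = 1/β_R`. -/
def jStar (βL βR : ℝ) : ℝ := conductivity βL βR * (1 / βL - 1 / βR)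

theorem isProbabilityMeasure_wallLaw {β : ℝ} (hβ : 0 < β) : IsProbabilityMeasure (wallLaw β) := by
  have hb : 0 < β / 2 := by positivity
  have e : wallDensity β = Set.indicator (Set.Ioi 0)
      (fun p => β * (p * Real.exp (-(β / 2) * p ^ 2))) := by
    funext p
    by_cases hp : 0 < p
    · have h : -β * p ^ 2 / 2 = -(β / 2) * p ^ 2 := by ring
      rw [Set.indicator_of_mem (Set.mem_Ioi.2 hp), wallDensity, if_pos hp, h]
      ring
    · rw [Set.indicator_of_notMem (by simpa using hp), wallDensity, if_neg hp]
  have hi : Integrable (wallDensity β) := by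
    rw [e]
    exact ((integrable_mul_exp_neg_mul_sq hb).const_mul β).indicator measurableSet_Ioi
  have h0 : 0 ≤ᵐ[volume] wallDensity β := by
    refine Filter.Eventually.of_forall fun p => ?_
    show 0 ≤ wallDensity β p
    unfold wallDensity
    split_ifs <;> positivity
  have hint : ∫ p, wallDensity β p = 1 := by
    rw [e, integral_indicator measurableSet_Ioi, integral_const_mul]
    have h := integral_rpow_mul_exp_neg_mul_rpow (p := 2) (q := 1) (b := β / 2)
      (by norm_num) (by norm_num) hb
    have h' : ∫ x in Set.Ioi (0 : ℝ), x * Real.exp (-(β / 2) * x ^ 2) =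
        ∫ x in Set.Ioi (0 : ℝ), x ^ (1 : ℝ) * Real.exp (-(β / 2) * x ^ (2 : ℝ)) := by
      refine setIntegral_congr_fun measurableSet_Ioi fun x _ => ?_
      simp only [Real.rpow_one, Real.rpow_two]
    rw [h', h]
    norm_num
    rw [Real.rpow_neg_one]
    field_simp
  refine ⟨?_⟩
  rw [wallLaw, withDensity_apply _ MeasurableSet.univ, Measure.restrict_univ,
    ← ofReal_integral_eq_lintegral_ofReal hi h0, hint, ENNReal.ofReal_one]

end

end ConfinedTracer

namespace ConfinedTracer

noncomputable section

/-! During a cycle, made of one flight from each wall, the particle exchanges an energy `ΔJ` and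
spends a time `Δt`, independently of the other cycles. When `E e^{λ ΔJ - θ Δt} < 1`, the moments
over successive cycles are summable, and `E e^{λ J[0,t]}` is at most of order `e^{θt}`; when
`E e^{λ ΔJ - θ Δt} > 1`, decomposing at the first flight shows that it is at least of this order. So
`f(λ)` is the least `θ` with `E e^{λ ΔJ - θ Δt} ≤ 1`. In other words, the epigraph of `f` is the
closed convex set of all `(λ, θ)` with `E e^{λ ΔJ - θ Δt} ≤ 1`, and `I` is its support function.

Since slow flights are not exponentially rare, the moment is infinite for `θ < 0`. This cuts the
epigraph off at `θ = 0`, along an edge from `(β_L - β_R, 0)` to `(0, 0)`. The origin supports all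
directions between the vertical and the normal of the curve `E e^{λ ΔJ - θ Δt} = 1`, which are those
of `j ∈ [0, j*]`. The moment is invariant under `λ ↦ β_L - β_R - λ`, whence the symmetry of `I`. For
`j > j*` the supporting point has `θ > 0`, where the moment is smooth and strictly log-convex, and
the inverse function theorem makes it depend smoothly on `j`. -/

section ExponentialTilt

variable {Ω : Type*} [MeasurableSpace Ω] {μ : Measure Ω} {w X : Ω → ℝ}

theorem log_integral_add_div_le_log_integral_mul_exp (hw : 0 ≤ᵐ[μ] w) (hw_pos : 0 < ∫ x, w x ∂μ)
    (hwX : Integrable (fun x => w x * X x) μ)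
    (hw_exp : Integrable (fun x => w x * Real.exp (X x)) μ) :
    Real.log (∫ x, w x ∂μ) + (∫ x, w x * X x ∂μ) / ∫ x, w x ∂μ ≤
      Real.log (∫ x, w x * Real.exp (X x) ∂μ) := by
  have hw_int : Integrable w μ := .of_integral_ne_zero hw_pos.ne'
  set m := (∫ x, w x * X x ∂μ) / ∫ x, w x ∂μ with hm
  have tangent_le : ∀ᵐ x ∂μ,
      Real.exp m * ((1 - m) * w x + w x * X x) ≤ w x * Real.exp (X x) := by
    filter_upwards [hw] with x hx
    calc Real.exp m * ((1 - m) * w x + w x * X x)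
        = w x * (Real.exp m * (X x - m + 1)) := by ring
      _ ≤ w x * (Real.exp m * Real.exp (X x - m)) := by
          have : 0 ≤ w x := hx
          gcongr
          exact Real.add_one_le_exp _
      _ = w x * Real.exp (X x) := by rw [← Real.exp_add, add_sub_cancel]
  have integral_tangent : ∫ x, Real.exp m * ((1 - m) * w x + w x * X x) ∂μ =
      Real.exp m * ∫ x, w x ∂μ := by
    rw [integral_const_mul, integral_add (hw_int.const_mul _) hwX, integral_const_mul,
      ← div_mul_cancel₀ (∫ x, w x * X x ∂μ) hw_pos.ne', ← hm]
    ring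
  have exp_mul_le : Real.exp m * ∫ x, w x ∂μ ≤ ∫ x, w x * Real.exp (X x) ∂μ :=
    integral_tangent ▸
      integral_mono_ae (((hw_int.const_mul _).add hwX).const_mul _) hw_exp tangent_le
  have := Real.log_le_log (by positivity) exp_mul_le
  rwa [Real.log_mul (Real.exp_ne_zero m) hw_pos.ne', Real.log_exp, add_comm] at this

theorem sq_integral_div_lt_integral_sq_div (hw : 0 ≤ᵐ[μ] w) (hw_pos : 0 < ∫ x, w x ∂μ)
    (hwX : Integrable (fun x => w x * X x) μ) (hwX_sq : Integrable (fun x => w x * X x ^ 2) μ)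
    (hX : ∀ c : ℝ, ¬ ∀ᵐ x ∂μ, w x * (X x - c) ^ 2 = 0) :
    ((∫ x, w x * X x ∂μ) / ∫ x, w x ∂μ) ^ 2 < (∫ x, w x * X x ^ 2 ∂μ) / ∫ x, w x ∂μ := by
  have hw_int : Integrable w μ := .of_integral_ne_zero hw_pos.ne'
  set c := (∫ x, w x * X x ∂μ) / ∫ x, w x ∂μ with hc
  have expand : (fun x => w x * (X x - c) ^ 2) =
      fun x => (w x * X x ^ 2 - 2 * c * (w x * X x)) + c ^ 2 * w x := by
    funext x
    ring
  have hdiff_int : Integrable (fun x => w x * X x ^ 2 - 2 * c * (w x * X x)) μ :=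
    hwX_sq.sub (hwX.const_mul _)
  have variance_int : Integrable (fun x => w x * (X x - c) ^ 2) μ :=
    expand ▸ hdiff_int.add (hw_int.const_mul _)
  have variance_nonneg : 0 ≤ᵐ[μ] fun x => w x * (X x - c) ^ 2 := by
    filter_upwards [hw] with x hx using mul_nonneg hx (sq_nonneg _)
  have variance_pos : 0 < ∫ x, w x * (X x - c) ^ 2 ∂μ :=
    (integral_nonneg_of_ae variance_nonneg).lt_of_ne fun h =>
      hX c ((integral_eq_zero_iff_of_nonneg_ae variance_nonneg variance_int).1 h.symm)
  rw [expand, integral_add hdiff_int (hw_int.const_mul _),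
    integral_sub hwX_sq (hwX.const_mul _), integral_const_mul, integral_const_mul,
    ← div_mul_cancel₀ (∫ x, w x * X x ∂μ) hw_pos.ne', ← hc] at variance_pos
  rw [lt_div_iff₀ hw_pos]
  linarith

end ExponentialTilt

/-- The integrand `p^a e^{-b p²/2 - θ/p}` of `moment`. For `a = 1` it is, up to normalization, the
density of the emission speed tilted by its square and by the crossing time `1/p`. -/
def momentKernel (a : ℤ) (b θ p : ℝ) : ℝ := p ^ a * Real.exp (-b * p ^ 2 / 2 - θ / p)

/-- The integral `∫_{p>0} p^a e^{-b p²/2 - θ/p} dp`. -/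
def moment (a : ℤ) (b θ : ℝ) : ℝ := ∫ p in Set.Ioi (0 : ℝ), momentKernel a b θ p

/-- The total mass `∫_{p>0} p e^{-b p²/2 - θ/p} dp` of the tilted emission density, with values
in `[0, ∞]`. -/
def mass (b θ : ℝ) : ENNReal := ∫⁻ p in Set.Ioi (0 : ℝ), ENNReal.ofReal (momentKernel 1 b θ p)

/-- The mean of `p^a` under the probability density proportional to `p e^{-b p²/2 - θ/p}`. -/
def tiltedMean (a : ℤ) (b θ : ℝ) : ℝ := moment (a + 1) b θ / moment 1 b θ

/-- The covariance of `p^a` and `p^c` under the probability density proportional to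
`p e^{-b p²/2 - θ/p}`. -/
def tiltedCov (a c : ℤ) (b θ : ℝ) : ℝ :=
  tiltedMean (a + c) b θ - tiltedMean a b θ * tiltedMean c b θ

theorem tiltedCov_comm (a c : ℤ) (b θ : ℝ) : tiltedCov a c b θ = tiltedCov c a b θ := by
  rw [tiltedCov, tiltedCov, add_comm, mul_comm]

section Moments

variable {a : ℤ} {b θ : ℝ}

theorem momentKernel_pos (a : ℤ) (b θ : ℝ) {p : ℝ} (hp : 0 < p) : 0 < momentKernel a b θ p :=
  mul_pos (zpow_pos hp a) (Real.exp_pos _)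

theorem ae_momentKernel_nonneg (a : ℤ) (b θ : ℝ) :
    0 ≤ᵐ[volume.restrict (Set.Ioi 0)] momentKernel a b θ :=
  ae_restrict_of_forall_mem measurableSet_Ioi fun _ hp => (momentKernel_pos a b θ hp).le

theorem continuousOn_momentKernel (a : ℤ) (b θ : ℝ) :
    ContinuousOn (momentKernel a b θ) (Set.Ioi 0) := by
  have hne : ∀ p ∈ Set.Ioi (0 : ℝ), p ≠ 0 := fun p hp => ne_of_gt hp
  exact (continuousOn_id.zpow₀ a fun p hp => .inl (hne p hp)).mul
    (by fun_prop (disch := assumption))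

theorem continuous_momentKernel_params (a : ℤ) (p : ℝ) :
    Continuous fun q : ℝ × ℝ => momentKernel a q.1 q.2 p := by
  simp only [momentKernel, div_eq_mul_inv]
  fun_prop

theorem aestronglyMeasurable_momentKernel (a : ℤ) (b θ : ℝ) :
    AEStronglyMeasurable (momentKernel a b θ) (volume.restrict (Set.Ioi 0)) :=
  (continuousOn_momentKernel a b θ).aestronglyMeasurable measurableSet_Ioi

theorem momentKernel_le_of_le (a : ℤ) {b' θ' p : ℝ} (hb : b ≤ b') (hθ : θ ≤ θ') (hp : 0 < p) :
    momentKernel a b' θ' p ≤ momentKernel a b θ p := by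
  unfold momentKernel
  gcongr

theorem momentKernel_one_lt_of_lt (b : ℝ) {θ' p : ℝ} (hθ : θ < θ') (hp : 0 < p) :
    momentKernel 1 b θ' p < momentKernel 1 b θ p := by
  unfold momentKernel
  gcongr

theorem integrableOn_momentKernel_of_nonneg (ha : 0 ≤ a) (hb : 0 < b) (hθ : 0 ≤ θ) :
    IntegrableOn (momentKernel a b θ) (Set.Ioi 0) := by
  lift a to ℕ using ha with n
  have hn : (-1 : ℝ) < n := neg_one_lt_zero.trans_le n.cast_nonneg
  refine (integrableOn_rpow_mul_exp_neg_mul_sq (half_pos hb) hn).mono'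
    (aestronglyMeasurable_momentKernel n b θ)
    (ae_restrict_of_forall_mem measurableSet_Ioi fun p hp => ?_)
  rw [Real.norm_of_nonneg (momentKernel_pos n b θ hp).le, Real.rpow_natCast, ← zpow_natCast]
  refine (momentKernel_le_of_le n le_rfl hθ hp).trans_eq ?_
  simp only [momentKernel, zero_div, sub_zero]
  ring_nf

theorem integrableOn_momentKernel (a : ℤ) (hb : 0 < b) (hθ : 0 < θ) :
    IntegrableOn (momentKernel a b θ) (Set.Ioi 0) := by
  rcases a.eq_nat_or_neg with ⟨n, rfl | rfl⟩
  · exact integrableOn_momentKernel_of_nonneg n.cast_nonneg hb hθ.le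
  have zpow_neg_mul_exp_le : ∀ p : ℝ, 0 < p →
      p ^ (-n : ℤ) * Real.exp (-(θ / p)) ≤ n.factorial / θ ^ n := by
    intro p hp
    have := Real.pow_div_factorial_le_exp (θ / p) (by positivity) n
    rw [div_pow, div_div, div_le_iff₀ (by positivity)] at this
    rw [zpow_neg, zpow_natCast, Real.exp_neg, ← mul_inv, le_div_iff₀ (by positivity),
      inv_mul_le_iff₀ (by positivity)]
    linarith
  refine ((integrableOn_momentKernel_of_nonneg le_rfl hb le_rfl).const_mul
    (n.factorial / θ ^ n)).mono'
    (aestronglyMeasurable_momentKernel _ b θ)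
    (ae_restrict_of_forall_mem measurableSet_Ioi fun p hp => ?_)
  rw [Real.norm_of_nonneg (momentKernel_pos _ b θ hp).le]
  simp only [momentKernel, zpow_zero, one_mul, zero_div, sub_zero]
  rw [sub_eq_add_neg, Real.exp_add, mul_comm (Real.exp _), ← mul_assoc]
  gcongr
  exact zpow_neg_mul_exp_le p hp

theorem integral_momentKernel (a : ℤ) (b θ : ℝ) :
    ∫ p in Set.Ioi (0 : ℝ), momentKernel a b θ p = moment a b θ :=
  rfl

theorem moment_pos (h : IntegrableOn (momentKernel a b θ) (Set.Ioi 0)) : 0 < moment a b θ := by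
  refine (setIntegral_pos_iff_support_of_nonneg_ae (ae_momentKernel_nonneg a b θ) h).2 ?_
  have : Set.Ioi (0 : ℝ) ⊆ Function.support (momentKernel a b θ) ∩ Set.Ioi 0 :=
    fun p hp => ⟨(momentKernel_pos a b θ hp).ne', hp⟩
  exact (by simp : 0 < volume (Set.Ioi (0 : ℝ))).trans_le (measure_mono this)

theorem moment_one_pos (hb : 0 < b) (hθ : 0 ≤ θ) : 0 < moment 1 b θ :=
  moment_pos (integrableOn_momentKernel_of_nonneg zero_le_one hb hθ)

theorem moment_natCast_zero (n : ℕ) (hb : 0 < b) :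
    moment n b 0 = (b / 2) ^ (-((n + 1) / 2) : ℝ) * (1 / 2) * Real.Gamma ((n + 1) / 2) := by
  rw [← neg_div, ← integral_rpow_mul_exp_neg_mul_rpow two_pos
    (neg_one_lt_zero.trans_le n.cast_nonneg) (half_pos hb)]
  refine setIntegral_congr_fun measurableSet_Ioi fun x _ => ?_
  simp only [momentKernel, Real.rpow_natCast, Real.rpow_two, zpow_natCast, zero_div, sub_zero]
  ring_nf

theorem moment_one_zero (hb : 0 < b) : moment 1 b 0 = 1 / b := by
  have h := moment_natCast_zero 1 hb
  norm_num [Real.rpow_neg_one] at h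
  rw [h]
  field_simp

theorem moment_three_zero (hb : 0 < b) : moment 3 b 0 = 2 / b ^ 2 := by
  have h := moment_natCast_zero 3 hb
  norm_num [Real.rpow_neg (half_pos hb).le] at h
  rw [h]
  field_simp

theorem moment_zero_zero (hb : 0 < b) : moment 0 b 0 = √(Real.pi * b / 2) / b := by
  have h := moment_natCast_zero 0 hb
  norm_num [Real.Gamma_one_half_eq, Real.rpow_neg (half_pos hb).le, ← Real.sqrt_eq_rpow] at h
  rw [h, mul_div_assoc, Real.sqrt_mul Real.pi_nonneg, Real.sqrt_div' _ zero_le_two]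
  have : √b ≠ 0 := by positivity
  field_simp
  rw [Real.sq_sqrt zero_le_two, Real.sq_sqrt hb.le, mul_comm]

theorem continuousOn_moment_of_nonneg (ha : 0 ≤ a) :
    ContinuousOn (fun q : ℝ × ℝ => moment a q.1 q.2) (Set.Ioi 0 ×ˢ Set.Ici 0) := by
  rintro ⟨b, θ⟩ ⟨hb : 0 < b, -⟩
  have near : ∀ᶠ q : ℝ × ℝ in 𝓝[Set.Ioi 0 ×ˢ Set.Ici 0] (b, θ), b / 2 ≤ q.1 ∧ 0 ≤ q.2 := by
    have hfst : ∀ᶠ q : ℝ × ℝ in 𝓝 (b, θ), b / 2 < q.1 :=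
      continuousAt_fst.eventually (lt_mem_nhds (half_lt_self hb))
    filter_upwards [nhdsWithin_le_nhds hfst, self_mem_nhdsWithin] with q hq hmem
      using ⟨hq.le, hmem.2⟩
  refine continuousWithinAt_of_dominated (bound := momentKernel a (b / 2) 0)
    (Eventually.of_forall fun q => aestronglyMeasurable_momentKernel a q.1 q.2) ?_
    (integrableOn_momentKernel_of_nonneg ha (half_pos hb) le_rfl)
    (Eventually.of_forall fun p => (continuous_momentKernel_params a p).continuousWithinAt)
  filter_upwards [near] with q hq
  refine ae_restrict_of_forall_mem measurableSet_Ioi fun p hp => ?_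
  rw [Real.norm_of_nonneg (momentKernel_pos a q.1 q.2 hp).le]
  exact momentKernel_le_of_le a hq.1 hq.2 hp

end Moments

section Mass

variable {b θ : ℝ}

theorem mass_eq_ofReal (hb : 0 < b) (hθ : 0 ≤ θ) : mass b θ = ENNReal.ofReal (moment 1 b θ) :=
  (ofReal_integral_eq_lintegral_ofReal (integrableOn_momentKernel_of_nonneg zero_le_one hb hθ)
    (ae_momentKernel_nonneg 1 b θ)).symm

theorem mass_eq_top_of_nonpos (hb : b ≤ 0) (θ : ℝ) : mass b θ = ⊤ := by
  have const_le : ∀ p ∈ Set.Ioi (1 : ℝ), Real.exp (-|θ|) ≤ momentKernel 1 b θ p := by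
    intro p hp
    have hp : 1 < p := hp
    have hθp : θ / p ≤ |θ| := (le_abs_self _).trans <| by
      rw [abs_div, abs_of_pos (zero_lt_one.trans hp)]
      exact div_le_self (abs_nonneg θ) hp.le
    have hbp : 0 ≤ -b * p ^ 2 / 2 := by
      have := neg_nonneg.2 hb
      positivity
    rw [momentKernel, zpow_one, ← one_mul (Real.exp (-|θ|))]
    gcongr
    linarith
  refine top_le_iff.1 ?_
  calc (⊤ : ENNReal) = ∫⁻ _ in Set.Ioi (1 : ℝ), ENNReal.ofReal (Real.exp (-|θ|)) := by
        rw [setLIntegral_const, Real.volume_Ioi, ENNReal.mul_top]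
        simpa using Real.exp_pos _
    _ ≤ ∫⁻ p in Set.Ioi (1 : ℝ), ENNReal.ofReal (momentKernel 1 b θ p) :=
        setLIntegral_mono' measurableSet_Ioi fun p hp => ENNReal.ofReal_le_ofReal (const_le p hp)
    _ ≤ mass b θ := lintegral_mono_set (Set.Ioi_subset_Ioi zero_le_one)

theorem exp_mul_inv_le_momentKernel_one (b : ℝ) (hθ : θ < 0) {p : ℝ} (hp : p ∈ Set.Ioo (0 : ℝ) 1) :
    Real.exp (-|b| / 2) * (θ ^ 2 / 2) * p⁻¹ ≤ momentKernel 1 b θ p := by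
  obtain ⟨hp0, hp1⟩ := hp
  have hexp : (-θ / p) ^ 2 / 2 ≤ Real.exp (-θ / p) := by
    simpa using Real.pow_div_factorial_le_exp (-θ / p) (div_nonneg (by linarith) hp0.le) 2
  have hgauss : Real.exp (-|b| / 2) ≤ Real.exp (-b * p ^ 2 / 2) := by
    have : b * p ^ 2 ≤ |b| := (le_abs_self _).trans <| by
      rw [abs_mul, abs_of_nonneg (sq_nonneg p)]
      exact mul_le_of_le_one_right (abs_nonneg b) (pow_le_one₀ hp0.le hp1.le)
    gcongr
    linarith
  calc Real.exp (-|b| / 2) * (θ ^ 2 / 2) * p⁻¹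
      = p * (Real.exp (-|b| / 2) * ((-θ / p) ^ 2 / 2)) := by field_simp
    _ ≤ p * (Real.exp (-b * p ^ 2 / 2) * Real.exp (-θ / p)) := by gcongr
    _ = momentKernel 1 b θ p := by rw [momentKernel, zpow_one, ← Real.exp_add]; ring_nf

theorem mass_eq_top_of_neg (b : ℝ) (hθ : θ < 0) : mass b θ = ⊤ := by
  by_contra hfin
  set c := Real.exp (-|b| / 2) * (θ ^ 2 / 2)
  have hc : 0 < c := by
    have := pow_pos (neg_pos.2 hθ) 2
    rw [neg_sq] at this
    positivity
  have hc_inv : IntegrableOn (fun p : ℝ => c * p⁻¹) (Set.Ioo 0 1) := by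
    refine ⟨by fun_prop, lt_of_le_of_lt ?_ (lt_top_iff_ne_top.2 hfin)⟩
    refine (setLIntegral_mono' measurableSet_Ioo fun p hp => ?_).trans
      (lintegral_mono_set Set.Ioo_subset_Ioi_self)
    have := hp.1
    rw [← ofReal_norm, Real.norm_of_nonneg (by positivity)]
    exact ENNReal.ofReal_le_ofReal (exp_mul_inv_le_momentKernel_one b hθ hp)
  have h_inv : IntegrableOn (fun p : ℝ => p ^ (-1 : ℝ)) (Set.Ioo 0 1) := by
    simpa only [IntegrableOn, Real.rpow_neg_one, inv_mul_cancel_left₀ hc.ne']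
      using hc_inv.const_mul c⁻¹
  exact lt_irrefl _ ((intervalIntegral.integrableOn_Ioo_rpow_iff zero_lt_one).1 h_inv)

theorem pos_and_nonneg_of_mass_ne_top (h : mass b θ ≠ ⊤) : 0 < b ∧ 0 ≤ θ :=
  ⟨not_le.1 fun hb => h (mass_eq_top_of_nonpos hb θ),
    not_lt.1 fun hθ => h (mass_eq_top_of_neg b hθ)⟩

theorem mass_pos (b θ : ℝ) : 0 < mass b θ := by
  by_cases h : mass b θ = ⊤
  · simp [h]
  · obtain ⟨hb, hθ⟩ := pos_and_nonneg_of_mass_ne_top h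
    simpa [mass_eq_ofReal hb hθ] using moment_one_pos hb hθ

theorem mass_strictAnti {θ' : ℝ} (h : θ < θ') (hfin : mass b θ' ≠ ⊤) : mass b θ' < mass b θ := by
  refine setLIntegral_strict_mono measurableSet_Ioi (by simp) ?_ hfin
    (Eventually.of_forall fun p hp => ?_)
  · unfold momentKernel
    simp only [zpow_one]
    fun_prop
  · exact (ENNReal.ofReal_lt_ofReal_iff (momentKernel_pos 1 b θ hp)).2
      (momentKernel_one_lt_of_lt b h hp)

theorem lowerSemicontinuous_mass : LowerSemicontinuous fun q : ℝ × ℝ => mass q.1 q.2 := by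
  refine lowerSemicontinuous_iff_le_liminf.2 fun q => ?_
  refine le_trans (lintegral_mono fun p => ?_) (lintegral_liminf_le' fun q =>
    (aestronglyMeasurable_momentKernel 1 q.1 q.2).aemeasurable.ennreal_ofReal)
  exact (ENNReal.continuous_ofReal.comp
    (continuous_momentKernel_params 1 p)).continuousAt.liminf_eq.ge

end Mass

section Differentiability

variable {b θ : ℝ}

/-- The linear form `x • fst + y • snd` on `ℝ × ℝ`. -/
def linearForm (x y : ℝ) : ℝ × ℝ →L[ℝ] ℝ :=
  x • ContinuousLinearMap.fst ℝ ℝ ℝ + y • ContinuousLinearMap.snd ℝ ℝ ℝ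

theorem linearForm_apply (x y : ℝ) (d : ℝ × ℝ) : linearForm x y d = x * d.1 + y * d.2 := rfl

theorem hasFDerivAt_linearForm_div {f g : ℝ × ℝ → ℝ} {q : ℝ × ℝ} {x y x' y' : ℝ}
    (hf : HasFDerivAt f (linearForm x y) q) (hg : HasFDerivAt g (linearForm x' y') q)
    (hne : g q ≠ 0) : HasFDerivAt (fun q => f q / g q)
      (linearForm ((x - f q / g q * x') / g q) ((y - f q / g q * y') / g q)) q := by
  have hinv := (hasDerivAt_inv hne).comp_hasFDerivAt q hg
  refine (hf.mul hinv).congr_fderiv ?_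
  ext <;> simp [linearForm] <;> field_simp <;> ring

theorem hasFDerivAt_linearForm_comp {f : ℝ × ℝ → ℝ} {g : ℝ × ℝ → ℝ} {q : ℝ × ℝ} {x y s : ℝ}
    (hf : HasFDerivAt f (linearForm x y) (g q, q.2)) (hg : HasFDerivAt g (linearForm s 0) q) :
    HasFDerivAt (fun q => f (g q, q.2)) (linearForm (x * s) y) q := by
  refine (hf.comp q (hg.prodMk hasFDerivAt_snd)).congr_fderiv ?_
  ext <;> simp [linearForm]

theorem norm_linearForm_le (x y : ℝ) : ‖linearForm x y‖ ≤ |x| + |y| := by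
  refine (norm_add_le _ _).trans (add_le_add ?_ ?_)
  · rw [norm_smul, Real.norm_eq_abs]
    exact mul_le_of_le_one_right (abs_nonneg x) (ContinuousLinearMap.norm_fst_le ℝ ℝ ℝ)
  · rw [norm_smul, Real.norm_eq_abs]
    exact mul_le_of_le_one_right (abs_nonneg y) (ContinuousLinearMap.norm_snd_le ℝ ℝ ℝ)

theorem integrable_linearForm {μ : Measure ℝ} {f g : ℝ → ℝ} (hf : Integrable f μ)
    (hg : Integrable g μ) : Integrable (fun p => linearForm (f p) (g p)) μ :=
  Integrable.add (f := fun p => f p • ContinuousLinearMap.fst ℝ ℝ ℝ) (hf.smul_const _)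
    (hg.smul_const _)

theorem integral_linearForm {μ : Measure ℝ} {f g : ℝ → ℝ} (hf : Integrable f μ)
    (hg : Integrable g μ) :
    ∫ p, linearForm (f p) (g p) ∂μ = linearForm (∫ p, f p ∂μ) (∫ p, g p ∂μ) := by
  simp only [linearForm]
  rw [integral_add (hf.smul_const _) (hg.smul_const _), integral_smul_const, integral_smul_const]

theorem hasFDerivAt_momentKernel (a : ℤ) {p : ℝ} (hp : 0 < p) (q : ℝ × ℝ) :
    HasFDerivAt (fun q : ℝ × ℝ => momentKernel a q.1 q.2 p)
      (linearForm (-(1 / 2) * momentKernel (a + 2) q.1 q.2 p) (-momentKernel (a - 1) q.1 q.2 p))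
      q := by
  have hexponent : HasFDerivAt (fun q : ℝ × ℝ => -q.1 * p ^ 2 / 2 - q.2 / p)
      (linearForm (-(p ^ 2 / 2)) (-p⁻¹)) q := by
    refine (linearForm (-(p ^ 2 / 2)) (-p⁻¹)).hasFDerivAt.congr_of_eventuallyEq
      (Eventually.of_forall fun x => ?_)
    simp only [linearForm_apply]
    ring
  refine (hexponent.exp.const_mul (p ^ a)).congr_fderiv ?_
  simp only [momentKernel, zpow_add₀ hp.ne', zpow_sub₀ hp.ne', zpow_one]
  ext <;> simp [linearForm] <;> ring

theorem hasFDerivAt_moment (a : ℤ) (hb : 0 < b) (hθ : 0 < θ) :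
    HasFDerivAt (fun q : ℝ × ℝ => moment a q.1 q.2)
      (linearForm (-(1 / 2) * moment (a + 2) b θ) (-moment (a - 1) b θ)) (b, θ) := by
  have hfst := (integrableOn_momentKernel (a + 2) hb hθ).const_mul (-(1 / 2))
  have hsnd : IntegrableOn (fun p => -momentKernel (a - 1) b θ p) (Set.Ioi 0) :=
    (integrableOn_momentKernel (a - 1) hb hθ).neg
  have near : Set.Ioi (b / 2) ×ˢ Set.Ioi (θ / 2) ∈ 𝓝 (b, θ) :=
    prod_mem_nhds (Ioi_mem_nhds (half_lt_self hb)) (Ioi_mem_nhds (half_lt_self hθ))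
  have bound : ∀ p ∈ Set.Ioi (0 : ℝ), ∀ q ∈ Set.Ioi (b / 2) ×ˢ Set.Ioi (θ / 2),
      ‖linearForm (-(1 / 2) * momentKernel (a + 2) q.1 q.2 p) (-momentKernel (a - 1) q.1 q.2 p)‖ ≤
        1 / 2 * momentKernel (a + 2) (b / 2) (θ / 2) p +
          momentKernel (a - 1) (b / 2) (θ / 2) p := by
    rintro p hp q ⟨hq1 : b / 2 < q.1, hq2 : θ / 2 < q.2⟩
    refine (norm_linearForm_le _ _).trans ?_
    rw [abs_neg, neg_mul, abs_neg, abs_of_pos (momentKernel_pos _ _ _ hp),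
      abs_of_pos (mul_pos one_half_pos (momentKernel_pos _ _ _ hp))]
    gcongr <;> exact momentKernel_le_of_le _ hq1.le hq2.le hp
  have main := hasFDerivAt_integral_of_dominated_of_fderiv_le (𝕜 := ℝ)
    (μ := volume.restrict (Set.Ioi 0)) (F := fun q : ℝ × ℝ => momentKernel a q.1 q.2)
    near (Eventually.of_forall fun q => aestronglyMeasurable_momentKernel a q.1 q.2)
    (integrableOn_momentKernel a hb hθ)
    (integrable_linearForm hfst hsnd).aestronglyMeasurable
    (ae_restrict_of_forall_mem measurableSet_Ioi bound)
    (((integrableOn_momentKernel (a + 2) (half_pos hb) (half_pos hθ)).const_mul _).add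
      (integrableOn_momentKernel (a - 1) (half_pos hb) (half_pos hθ)))
    (ae_restrict_of_forall_mem measurableSet_Ioi fun p hp q _ => hasFDerivAt_momentKernel a hp q)
  exact main.congr_fderiv <| by
    rw [integral_linearForm hfst hsnd, integral_const_mul, integral_neg, moment, moment]

theorem contDiffOn_moment (a : ℤ) :
    ContDiffOn ℝ (⊤ : ℕ∞) (fun q : ℝ × ℝ => moment a q.1 q.2) (Set.Ioi 0 ×ˢ Set.Ioi 0) := by
  have hopen : IsOpen (Set.Ioi (0 : ℝ) ×ˢ Set.Ioi (0 : ℝ)) := isOpen_Ioi.prod isOpen_Ioi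
  have hderiv : ∀ a : ℤ, ∀ q ∈ Set.Ioi (0 : ℝ) ×ˢ Set.Ioi (0 : ℝ),
      HasFDerivWithinAt (fun q : ℝ × ℝ => moment a q.1 q.2)
        (linearForm (-(1 / 2) * moment (a + 2) q.1 q.2) (-moment (a - 1) q.1 q.2))
        (Set.Ioi 0 ×ˢ Set.Ioi 0) q :=
    fun a q hq => (hasFDerivAt_moment a hq.1 hq.2).hasFDerivWithinAt
  refine contDiffOn_infty.2 fun n => ?_
  induction n generalizing a with
  | zero => exact contDiffOn_zero.2 fun q hq => (hderiv a q hq).continuousWithinAt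
  | succ n ih =>
    push_cast
    refine (contDiffOn_succ_iff_hasFDerivWithinAt_of_uniqueDiffOn hopen.uniqueDiffOn).2
      ⟨by simp, _, ?_, hderiv a⟩
    exact ((contDiffOn_const.mul (ih (a + 2))).smul contDiffOn_const).add
      ((ih (a - 1)).neg.smul contDiffOn_const)

end Differentiability

section TiltedMean

variable {b θ : ℝ}

theorem tiltedMean_pos {a : ℤ} (hb : 0 < b) (hθ : 0 ≤ θ)
    (h : IntegrableOn (momentKernel (a + 1) b θ) (Set.Ioi 0)) : 0 < tiltedMean a b θ :=
  div_pos (moment_pos h) (moment_one_pos hb hθ)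

theorem tiltedMean_two_zero (hb : 0 < b) : tiltedMean 2 b 0 = 2 / b := by
  norm_num [tiltedMean, moment_three_zero hb, moment_one_zero hb]
  field_simp

theorem tiltedMean_neg_one_zero (hb : 0 < b) : tiltedMean (-1) b 0 = √(Real.pi * b / 2) := by
  norm_num [tiltedMean, moment_zero_zero hb, moment_one_zero hb, hb.ne']

theorem contDiffOn_tiltedMean (a : ℤ) :
    ContDiffOn ℝ (⊤ : ℕ∞) (fun q : ℝ × ℝ => tiltedMean a q.1 q.2) (Set.Ioi 0 ×ˢ Set.Ioi 0) :=
  (contDiffOn_moment (a + 1)).div (contDiffOn_moment 1)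
    fun _ hq => (moment_one_pos hq.1 (le_of_lt hq.2)).ne'

theorem continuousOn_tiltedMean_of_nonneg {a : ℤ} (ha : -1 ≤ a) :
    ContinuousOn (fun q : ℝ × ℝ => tiltedMean a q.1 q.2) (Set.Ioi 0 ×ˢ Set.Ici 0) :=
  (continuousOn_moment_of_nonneg (by lia)).div (continuousOn_moment_of_nonneg zero_le_one)
    fun _ hq => (moment_one_pos hq.1 hq.2).ne'

theorem momentKernel_one_mul_add (α γ b θ : ℝ) {p : ℝ} (hp : 0 < p) :
    momentKernel 1 b θ p * (α * p ^ 2 + γ / p) =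
      α * momentKernel 3 b θ p + γ * momentKernel 0 b θ p := by
  simp only [momentKernel, zpow_ofNat]
  field_simp

theorem momentKernel_one_mul_add_sq (α γ b θ : ℝ) {p : ℝ} (hp : 0 < p) :
    momentKernel 1 b θ p * (α * p ^ 2 + γ / p) ^ 2 =
      α ^ 2 * momentKernel 5 b θ p + 2 * α * γ * momentKernel 2 b θ p +
        γ ^ 2 * momentKernel (-1) b θ p := by
  simp only [momentKernel, zpow_ofNat, zpow_neg_one]
  field_simp
  ring

theorem momentKernel_one_mul_exp (b θ b' θ' p : ℝ) :
    momentKernel 1 b θ p * Real.exp (-(b' - b) / 2 * p ^ 2 + -(θ' - θ) / p) =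
      momentKernel 1 b' θ' p := by
  rw [momentKernel, momentKernel, mul_assoc, ← Real.exp_add]
  ring_nf

theorem log_moment_add_le_log_moment {b' θ' : ℝ} (hb : 0 < b) (hθ : 0 ≤ θ) (hb' : 0 < b')
    (hθ' : 0 ≤ θ') :
    Real.log (moment 1 b θ) - (b' - b) / 2 * tiltedMean 2 b θ - (θ' - θ) * tiltedMean (-1) b θ ≤
      Real.log (moment 1 b' θ') := by
  have hthree := (integrableOn_momentKernel_of_nonneg zero_le_three hb hθ).const_mul (-(b' - b) / 2)
  have hzero := (integrableOn_momentKernel_of_nonneg le_rfl hb hθ).const_mul (-(θ' - θ))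
  have hX : Set.EqOn (fun p => momentKernel 1 b θ p * (-(b' - b) / 2 * p ^ 2 + -(θ' - θ) / p))
      (fun p => -(b' - b) / 2 * momentKernel 3 b θ p + -(θ' - θ) * momentKernel 0 b θ p)
      (Set.Ioi 0) := fun p hp => momentKernel_one_mul_add _ _ b θ hp
  have jensen := log_integral_add_div_le_log_integral_mul_exp (ae_momentKernel_nonneg 1 b θ)
    (moment_one_pos hb hθ)
    ((integrableOn_congr_fun hX measurableSet_Ioi).2 (hthree.add hzero))
    ((integrableOn_momentKernel_of_nonneg zero_le_one hb' hθ').congr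
      (Eventually.of_forall fun p => (momentKernel_one_mul_exp b θ b' θ' p).symm))
  rw [setIntegral_congr_fun measurableSet_Ioi hX, integral_add hthree hzero,
    integral_const_mul, integral_const_mul] at jensen
  simp only [momentKernel_one_mul_exp, integral_momentKernel] at jensen
  refine le_trans (le_of_eq ?_) jensen
  have h := (moment_one_pos hb hθ).ne'
  norm_num [tiltedMean]
  field_simp
  ring

theorem not_ae_momentKernel_mul_sq_eq_zero {α : ℝ} (hα : α ≠ 0) (γ c b θ : ℝ) :
    ¬ ∀ᵐ p ∂volume.restrict (Set.Ioi 0),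
      momentKernel 1 b θ p * (α * p ^ 2 + γ / p - c) ^ 2 = 0 := by
  intro h
  have hne : ∀ p ∈ Set.Ioi (0 : ℝ), p ≠ 0 := fun p hp => ne_of_gt hp
  have hcont : ContinuousOn (fun p => momentKernel 1 b θ p * (α * p ^ 2 + γ / p - c) ^ 2)
      (Set.Ioi 0) :=
    (continuousOn_momentKernel 1 b θ).mul (by fun_prop (disch := assumption))
  have eq_zero : ∀ p : ℝ, 0 < p → α * p ^ 2 + γ / p - c = 0 := by
    intro p hp
    have := Measure.eqOn_open_of_ae_eq h isOpen_Ioi hcont continuousOn_const hp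
    simpa [(momentKernel_pos 1 b θ hp).ne'] using this
  have h1 := eq_zero 1 (by norm_num)
  have h2 := eq_zero 2 (by norm_num)
  have h4 := eq_zero 4 (by norm_num)
  exact hα (by linarith)

theorem tiltedCov_quadratic_pos {α : ℝ} (hα : α ≠ 0) (γ : ℝ) (hb : 0 < b) (hθ : 0 < θ) :
    0 < α ^ 2 * tiltedCov 2 2 b θ + 2 * α * γ * tiltedCov 2 (-1) b θ +
      γ ^ 2 * tiltedCov (-1) (-1) b θ := by
  have hint := fun (c : ℝ) (a : ℤ) => (integrableOn_momentKernel a hb hθ).const_mul c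
  have hX : Set.EqOn (fun p => momentKernel 1 b θ p * (α * p ^ 2 + γ / p))
      (fun p => α * momentKernel 3 b θ p + γ * momentKernel 0 b θ p) (Set.Ioi 0) :=
    fun p hp => momentKernel_one_mul_add α γ b θ hp
  have hX_sq : Set.EqOn (fun p => momentKernel 1 b θ p * (α * p ^ 2 + γ / p) ^ 2)
      (fun p => α ^ 2 * momentKernel 5 b θ p + 2 * α * γ * momentKernel 2 b θ p +
        γ ^ 2 * momentKernel (-1) b θ p) (Set.Ioi 0) :=
    fun p hp => momentKernel_one_mul_add_sq α γ b θ hp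
  have hsum : IntegrableOn
      (fun p => α ^ 2 * momentKernel 5 b θ p + 2 * α * γ * momentKernel 2 b θ p) (Set.Ioi 0) :=
    (hint _ 5).add (hint _ 2)
  have variance_pos := sq_integral_div_lt_integral_sq_div (ae_momentKernel_nonneg 1 b θ)
    (moment_one_pos hb hθ.le)
    ((integrableOn_congr_fun hX measurableSet_Ioi).2 ((hint α 3).add (hint γ 0)))
    ((integrableOn_congr_fun hX_sq measurableSet_Ioi).2 (hsum.add (hint (γ ^ 2) (-1))))
    fun c => not_ae_momentKernel_mul_sq_eq_zero hα γ c b θ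
  rw [setIntegral_congr_fun measurableSet_Ioi hX, setIntegral_congr_fun measurableSet_Ioi hX_sq,
    integral_add (hint _ 3) (hint _ 0), integral_add hsum (hint _ (-1)),
    integral_add (hint _ 5) (hint _ 2), ← sub_pos] at variance_pos
  simp only [integral_const_mul, integral_momentKernel] at variance_pos
  refine variance_pos.trans_eq ?_
  norm_num [tiltedCov, tiltedMean]
  ring

theorem hasFDerivAt_log_moment (hb : 0 < b) (hθ : 0 < θ) :
    HasFDerivAt (fun q : ℝ × ℝ => Real.log (moment 1 q.1 q.2))
      (linearForm (-(1 / 2) * tiltedMean 2 b θ) (-tiltedMean (-1) b θ)) (b, θ) := by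
  refine ((hasFDerivAt_moment 1 hb hθ).log (moment_one_pos hb hθ.le).ne').congr_fderiv ?_
  ext <;> norm_num [linearForm, tiltedMean] <;> ring

theorem hasFDerivAt_tiltedMean (a : ℤ) (hb : 0 < b) (hθ : 0 < θ) :
    HasFDerivAt (fun q : ℝ × ℝ => tiltedMean a q.1 q.2)
      (linearForm (-(1 / 2) * tiltedCov a 2 b θ) (-tiltedCov a (-1) b θ)) (b, θ) := by
  have hne := (moment_one_pos hb hθ.le).ne'
  refine (hasFDerivAt_linearForm_div (hasFDerivAt_moment (a + 1) hb hθ)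
    (hasFDerivAt_moment 1 hb hθ) hne).congr_fderiv ?_
  congr 1 <;> norm_num [tiltedCov, tiltedMean, add_right_comm a 2 1] <;> field_simp <;> ring

end TiltedMean

variable {βL βR : ℝ}

/-- The exponential moment `E e^{λ ΔJ - θ Δt}` of the energy `ΔJ` exchanged and of the time `Δt`
elapsed during one cycle, that is, one flight starting from each wall. -/
def cycleMass (βL βR l θ : ℝ) : ENNReal :=
  ENNReal.ofReal (βL * βR) * (mass (βL - l) θ * mass (βR + l) θ)

/-- The set of all `(λ, θ)` with `E e^{λ ΔJ - θ Δt} ≤ 1`. It is the closed epigraph of the cumulant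
generating function, hence its name. -/
def epigraph (βL βR : ℝ) : Set (ℝ × ℝ) := {q | cycleMass βL βR q.1 q.2 ≤ 1}

/-- The set of all `(λ, θ)` at which the exponential moment of one cycle is finite. -/
def cycleDomain (βL βR : ℝ) : Set (ℝ × ℝ) := Set.Ioo (-βR) βL ×ˢ Set.Ici 0

/-- The interior of `cycleDomain βL βR`. -/
def openCycleDomain (βL βR : ℝ) : Set (ℝ × ℝ) := Set.Ioo (-βR) βL ×ˢ Set.Ioi 0

/-- The logarithm of the exponential moment of one cycle, meaningful on `cycleDomain βL βR`. -/
def cycleCgf (βL βR : ℝ) (q : ℝ × ℝ) : ℝ :=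
  Real.log (βL * βR) + (Real.log (moment 1 (βL - q.1) q.2) + Real.log (moment 1 (βR + q.1) q.2))

/-- The mean of the energy exchanged during one cycle, under the exponentially tilted law. -/
def cycleEnergy (βL βR : ℝ) (q : ℝ × ℝ) : ℝ :=
  (tiltedMean 2 (βL - q.1) q.2 - tiltedMean 2 (βR + q.1) q.2) / 2

/-- The mean duration of one cycle, under the exponentially tilted law. -/
def cycleTime (βL βR : ℝ) (q : ℝ × ℝ) : ℝ :=
  tiltedMean (-1) (βL - q.1) q.2 + tiltedMean (-1) (βR + q.1) q.2

/-- The mean energy current of the exponentially tilted process. -/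
def cycleCurrent (βL βR : ℝ) (q : ℝ × ℝ) : ℝ := cycleEnergy βL βR q / cycleTime βL βR q

theorem pos_of_mem_cycleDomain {q : ℝ × ℝ} (hq : q ∈ cycleDomain βL βR) :
    0 < βL - q.1 ∧ 0 < βR + q.1 ∧ 0 ≤ q.2 :=
  ⟨sub_pos.2 hq.1.2, neg_lt_iff_pos_add'.1 hq.1.1, hq.2⟩

theorem openCycleDomain_subset : openCycleDomain βL βR ⊆ cycleDomain βL βR :=
  Set.prod_mono_right Set.Ioi_subset_Ici_self

theorem isOpen_openCycleDomain : IsOpen (openCycleDomain βL βR) := isOpen_Ioo.prod isOpen_Ioi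

theorem zero_mem_cycleDomain (hL : 0 < βL) (hR : 0 < βR) : (0, 0) ∈ cycleDomain βL βR :=
  ⟨⟨neg_lt_zero.2 hR, hL⟩, le_refl (0 : ℝ)⟩

theorem cycleTime_pos {q : ℝ × ℝ} (hq : q ∈ cycleDomain βL βR) : 0 < cycleTime βL βR q := by
  obtain ⟨hbL, hbR, hθ⟩ := pos_of_mem_cycleDomain hq
  have tiltedMean_pos' {b : ℝ} (hb : 0 < b) : 0 < tiltedMean (-1) b q.2 :=
    tiltedMean_pos hb hθ (integrableOn_momentKernel_of_nonneg (by norm_num) hb hθ)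
  exact add_pos (tiltedMean_pos' hbL) (tiltedMean_pos' hbR)

section Epigraph

theorem mass_ne_top_of_cycleMass_ne_top (hL : 0 < βL) (hR : 0 < βR) {l θ : ℝ}
    (h : cycleMass βL βR l θ ≠ ⊤) : mass (βL - l) θ ≠ ⊤ ∧ mass (βR + l) θ ≠ ⊤ := by
  have hC : ENNReal.ofReal (βL * βR) ≠ 0 := by simpa using mul_pos hL hR
  have hmul : mass (βL - l) θ * mass (βR + l) θ ≠ ⊤ := fun e => h (by
    rw [cycleMass, e, ENNReal.mul_top hC])
  exact ⟨fun e => hmul (by rw [e, ENNReal.top_mul (mass_pos _ _).ne']),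
    fun e => hmul (by rw [e, ENNReal.mul_top (mass_pos _ _).ne'])⟩

theorem mem_cycleDomain_of_cycleMass_ne_top (hL : 0 < βL) (hR : 0 < βR) {l θ : ℝ}
    (h : cycleMass βL βR l θ ≠ ⊤) : (l, θ) ∈ cycleDomain βL βR := by
  obtain ⟨hmL, hmR⟩ := mass_ne_top_of_cycleMass_ne_top hL hR h
  exact ⟨⟨neg_lt_iff_pos_add'.2 (pos_and_nonneg_of_mass_ne_top hmR).1,
    sub_pos.1 (pos_and_nonneg_of_mass_ne_top hmL).1⟩, (pos_and_nonneg_of_mass_ne_top hmL).2⟩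

theorem cycleMass_eq_ofReal_exp_cycleCgf (hL : 0 < βL) (hR : 0 < βR) {q : ℝ × ℝ}
    (hq : q ∈ cycleDomain βL βR) :
    cycleMass βL βR q.1 q.2 = ENNReal.ofReal (Real.exp (cycleCgf βL βR q)) := by
  obtain ⟨hbL, hbR, hθ⟩ := pos_of_mem_cycleDomain hq
  have hmL := moment_one_pos hbL hθ
  have hmR := moment_one_pos hbR hθ
  rw [cycleMass, mass_eq_ofReal hbL hθ, mass_eq_ofReal hbR hθ, ← ENNReal.ofReal_mul hmL.le,
    ← ENNReal.ofReal_mul (by positivity), cycleCgf, Real.exp_add, Real.exp_add,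
    Real.exp_log (by positivity), Real.exp_log hmL, Real.exp_log hmR]

theorem cycleMass_ne_top_of_mem_cycleDomain (hL : 0 < βL) (hR : 0 < βR) {l θ : ℝ}
    (hq : (l, θ) ∈ cycleDomain βL βR) : cycleMass βL βR l θ ≠ ⊤ :=
  (cycleMass_eq_ofReal_exp_cycleCgf hL hR hq).trans_ne ENNReal.ofReal_ne_top

theorem cycleMass_strictAnti (hL : 0 < βL) (hR : 0 < βR) {l θ θ' : ℝ} (h : θ < θ')
    (hfin : cycleMass βL βR l θ' ≠ ⊤) : cycleMass βL βR l θ' < cycleMass βL βR l θ := by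
  obtain ⟨hmL, hmR⟩ := mass_ne_top_of_cycleMass_ne_top hL hR hfin
  have hC : ENNReal.ofReal (βL * βR) ≠ 0 := by simpa using mul_pos hL hR
  exact (ENNReal.mul_lt_mul_iff_right hC ENNReal.ofReal_ne_top).2
    (ENNReal.mul_lt_mul (mass_strictAnti h hmL) (mass_strictAnti h hmR))

theorem epigraph_subset_cycleDomain (hL : 0 < βL) (hR : 0 < βR) :
    epigraph βL βR ⊆ cycleDomain βL βR := fun _ hq =>
  mem_cycleDomain_of_cycleMass_ne_top hL hR (ne_top_of_le_ne_top ENNReal.one_ne_top hq)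

theorem mem_epigraph_of_le (hL : 0 < βL) (hR : 0 < βR) {l r r' : ℝ}
    (h : (l, r) ∈ epigraph βL βR) (hr : r ≤ r') : (l, r') ∈ epigraph βL βR := by
  rcases hr.eq_or_lt with rfl | hlt
  · exact h
  · obtain ⟨hl, hr₀⟩ := epigraph_subset_cycleDomain hL hR h
    have hle : cycleMass βL βR l r ≤ 1 := h
    have hdom : (l, r') ∈ cycleDomain βL βR := ⟨hl, Set.mem_Ici.2 ((Set.mem_Ici.1 hr₀).trans hr)⟩
    have hfin : cycleMass βL βR l r' ≠ ⊤ := cycleMass_ne_top_of_mem_cycleDomain hL hR hdom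
    exact (cycleMass_strictAnti hL hR hlt hfin).le.trans hle

theorem mem_epigraph_iff (hL : 0 < βL) (hR : 0 < βR) {q : ℝ × ℝ} (hq : q ∈ cycleDomain βL βR) :
    q ∈ epigraph βL βR ↔ cycleCgf βL βR q ≤ 0 := by
  rw [epigraph, Set.mem_ofPred_eq, cycleMass_eq_ofReal_exp_cycleCgf hL hR hq, ENNReal.ofReal_le_one,
    Real.exp_le_one_iff]

theorem lowerSemicontinuous_cycleMass :
    LowerSemicontinuous fun q : ℝ × ℝ => cycleMass βL βR q.1 q.2 := by
  have hmL : LowerSemicontinuous fun q : ℝ × ℝ => mass (βL - q.1) q.2 :=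
    lowerSemicontinuous_mass.comp (g := fun q : ℝ × ℝ => (βL - q.1, q.2)) (by fun_prop)
  have hmR : LowerSemicontinuous fun q : ℝ × ℝ => mass (βR + q.1) q.2 :=
    lowerSemicontinuous_mass.comp (g := fun q : ℝ × ℝ => (βR + q.1, q.2)) (by fun_prop)
  rw [lowerSemicontinuous_iff_le_liminf] at *
  intro q
  calc cycleMass βL βR q.1 q.2
      ≤ ENNReal.ofReal (βL * βR) *
        liminf (fun q : ℝ × ℝ => mass (βL - q.1) q.2 * mass (βR + q.1) q.2) (𝓝 q) :=
        mul_le_mul_right ((mul_le_mul' (hmL q) (hmR q)).trans ENNReal.le_liminf_mul) _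
    _ = _ := (ENNReal.liminf_const_mul_of_ne_top ENNReal.ofReal_ne_top).symm

theorem isClosed_epigraph : IsClosed (epigraph βL βR) :=
  lowerSemicontinuous_cycleMass.isClosed_preimage 1

theorem reflect_mem_epigraph {q : ℝ × ℝ} (hq : q ∈ epigraph βL βR) :
    (βL - βR - q.1, q.2) ∈ epigraph βL βR := by
  have hreflect : cycleMass βL βR (βL - βR - q.1) q.2 = cycleMass βL βR q.1 q.2 := by
    rw [cycleMass, cycleMass, mul_comm (mass (βL - q.1) q.2)]
    ring_nf
  exact hreflect.trans_le hq

theorem cycleCgf_zero (hL : 0 < βL) (hR : 0 < βR) : cycleCgf βL βR (0, 0) = 0 := by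
  simp only [cycleCgf, sub_zero, add_zero, moment_one_zero hL, moment_one_zero hR, one_div,
    Real.log_inv, Real.log_mul hL.ne' hR.ne']
  ring

theorem cycleCurrent_zero (hL : 0 < βL) (hR : 0 < βR) :
    cycleCurrent βL βR (0, 0) = jStar βL βR := by
  simp only [cycleCurrent, cycleEnergy, cycleTime, jStar, conductivity, sub_zero, add_zero,
    tiltedMean_two_zero hL, tiltedMean_two_zero hR, tiltedMean_neg_one_zero hL,
    tiltedMean_neg_one_zero hR]
  ring

theorem zero_mem_epigraph (hL : 0 < βL) (hR : 0 < βR) : (0, 0) ∈ epigraph βL βR :=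
  (mem_epigraph_iff hL hR (zero_mem_cycleDomain hL hR)).2 (cycleCgf_zero hL hR).le

theorem jStar_nonneg (hL : 0 < βL) (hLR : βL ≤ βR) : 0 ≤ jStar βL βR :=
  mul_nonneg (inv_nonneg.2 (by positivity)) (sub_nonneg.2 (one_div_le_one_div_of_le hL hLR))

theorem cycleCgf_add_le_cycleCgf {q q' : ℝ × ℝ} (hq : q ∈ cycleDomain βL βR)
    (hq' : q' ∈ cycleDomain βL βR) :
    cycleCgf βL βR q + ((q'.1 - q.1) * cycleEnergy βL βR q - (q'.2 - q.2) * cycleTime βL βR q) ≤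
      cycleCgf βL βR q' := by
  obtain ⟨hbL, hbR, hθ⟩ := pos_of_mem_cycleDomain hq
  obtain ⟨hbL', hbR', hθ'⟩ := pos_of_mem_cycleDomain hq'
  have left := log_moment_add_le_log_moment hbL hθ hbL' hθ'
  have right := log_moment_add_le_log_moment hbR hθ hbR' hθ'
  rw [cycleCgf, cycleCgf, cycleEnergy, cycleTime]
  linear_combination left + right

theorem isMaxOn_epigraph_of_cycleCgf_eq_zero (hL : 0 < βL) (hR : 0 < βR) {q : ℝ × ℝ}
    (hq : q ∈ cycleDomain βL βR) (hcgf : cycleCgf βL βR q = 0) :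
    IsMaxOn (fun q' => q'.1 * cycleCurrent βL βR q - q'.2) (epigraph βL βR) q := by
  intro q' hq'
  have hdom := epigraph_subset_cycleDomain hL hR hq'
  have tangent := (cycleCgf_add_le_cycleCgf hq hdom).trans ((mem_epigraph_iff hL hR hdom).1 hq')
  rw [hcgf, zero_add, sub_nonpos, ← div_le_iff₀ (cycleTime_pos hq), mul_div_assoc,
    ← cycleCurrent] at tangent
  change q'.1 * cycleCurrent βL βR q - q'.2 ≤ q.1 * cycleCurrent βL βR q - q.2
  linear_combination tangent

theorem mul_jStar_le_of_mem_epigraph (hL : 0 < βL) (hR : 0 < βR) {q : ℝ × ℝ}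
    (hq : q ∈ epigraph βL βR) : q.1 * jStar βL βR ≤ q.2 := by
  have hmax := isMaxOn_epigraph_of_cycleCgf_eq_zero hL hR (zero_mem_cycleDomain hL hR)
    (cycleCgf_zero hL hR) hq
  rw [cycleCurrent_zero hL hR] at hmax
  simpa using hmax

theorem continuousOn_cycleEnergy : ContinuousOn (cycleEnergy βL βR) (cycleDomain βL βR) := by
  have hmean := continuousOn_tiltedMean_of_nonneg (a := 2) (by norm_num)
  exact ((hmean.comp (f := fun q : ℝ × ℝ => (βL - q.1, q.2)) (by fun_prop)
      fun q hq => ⟨(pos_of_mem_cycleDomain hq).1, hq.2⟩).sub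
    (hmean.comp (f := fun q : ℝ × ℝ => (βR + q.1, q.2)) (by fun_prop)
      fun q hq => ⟨(pos_of_mem_cycleDomain hq).2.1, hq.2⟩)).div_const 2

theorem continuousOn_cycleTime : ContinuousOn (cycleTime βL βR) (cycleDomain βL βR) := by
  have hmean := continuousOn_tiltedMean_of_nonneg (a := -1) le_rfl
  exact (hmean.comp (f := fun q : ℝ × ℝ => (βL - q.1, q.2)) (by fun_prop)
      fun q hq => ⟨(pos_of_mem_cycleDomain hq).1, hq.2⟩).add
    (hmean.comp (f := fun q : ℝ × ℝ => (βR + q.1, q.2)) (by fun_prop)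
      fun q hq => ⟨(pos_of_mem_cycleDomain hq).2.1, hq.2⟩)

theorem continuousOn_cycleCurrent : ContinuousOn (cycleCurrent βL βR) (cycleDomain βL βR) :=
  continuousOn_cycleEnergy.div continuousOn_cycleTime fun _ hq => (cycleTime_pos hq).ne'

/- Along the ray `θ = j' λ` with `j* < j' < j`, the tangent inequality bounds `cycleCgf` by `λ`
times a quantity that is negative for small `λ`, because the mean current is close to `j*` there. -/
theorem exists_mem_epigraph_lt (hL : 0 < βL) (hLR : βL ≤ βR) {j : ℝ} (hj : jStar βL βR < j) :
    ∃ q ∈ epigraph βL βR, 0 < q.1 * j - q.2 := by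
  have hR := hL.trans_le hLR
  obtain ⟨j', hj', hj'j⟩ := exists_between hj
  have hdom : ∀ᶠ l in 𝓝[>] (0 : ℝ), (l, l * j') ∈ cycleDomain βL βR := by
    filter_upwards [Ioo_mem_nhdsGT hL] with l hl
    exact ⟨⟨(neg_lt_zero.2 hR).trans hl.1, hl.2⟩,
      mul_nonneg hl.1.le ((jStar_nonneg hL hLR).trans hj'.le)⟩
  have hray : Tendsto (fun l : ℝ => (l, l * j')) (𝓝[>] 0) (𝓝[cycleDomain βL βR] (0, 0)) :=
    tendsto_nhdsWithin_iff.2 ⟨(Continuous.tendsto' (by fun_prop) _ _ (by simp)).mono_left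
      nhdsWithin_le_nhds, hdom⟩
  have hcurrent : ∀ᶠ l in 𝓝[>] (0 : ℝ), cycleCurrent βL βR (l, l * j') < j' :=
    ((continuousOn_cycleCurrent _ (zero_mem_cycleDomain hL hR)).tendsto.comp hray).eventually
      (gt_mem_nhds ((cycleCurrent_zero hL hR).trans_lt hj'))
  obtain ⟨l, ⟨hq, hlt⟩, hl⟩ := ((hdom.and hcurrent).and self_mem_nhdsWithin).exists
  refine ⟨(l, l * j'), (mem_epigraph_iff hL hR hq).2 ?_,
    sub_pos.2 (mul_lt_mul_of_pos_left hj'j hl)⟩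
  have tangent := cycleCgf_add_le_cycleCgf hq (zero_mem_cycleDomain hL hR)
  rw [cycleCgf_zero hL hR] at tangent
  rw [cycleCurrent, div_lt_iff₀ (cycleTime_pos hq)] at hlt
  linear_combination tangent + mul_le_mul_of_nonneg_left hlt.le (le_of_lt hl)

theorem exists_isMaxOn_epigraph (hL : 0 < βL) (hR : 0 < βR) (j : ℝ) :
    ∃ q ∈ epigraph βL βR, IsMaxOn (fun q => q.1 * j - q.2) (epigraph βL βR) q := by
  have hcont : Continuous fun q : ℝ × ℝ => q.1 * j - q.2 := by fun_prop
  have hclosed : IsClosed (epigraph βL βR ∩ {q | 0 ≤ q.1 * j - q.2}) :=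
    isClosed_epigraph.inter (isClosed_le continuous_const hcont)
  have hsub : epigraph βL βR ∩ {q | 0 ≤ q.1 * j - q.2} ⊆
      Set.Icc (-βR) βL ×ˢ Set.Icc 0 (max (βL * j) (-βR * j)) := by
    rintro q ⟨hq, hval⟩
    obtain ⟨⟨hlo, hhi⟩, hθ⟩ := epigraph_subset_cycleDomain hL hR hq
    refine ⟨⟨hlo.le, hhi.le⟩, hθ, (sub_nonneg.1 hval).trans ?_⟩
    rcases le_total 0 j with hj | hj
    · exact le_max_of_le_left (mul_le_mul_of_nonneg_right hhi.le hj)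
    · exact le_max_of_le_right (mul_le_mul_of_nonpos_right hlo.le hj)
  obtain ⟨q, hq, hmax⟩ := ((isCompact_Icc.prod isCompact_Icc).of_isClosed_subset hclosed
    hsub).exists_isMaxOn ⟨(0, 0), zero_mem_epigraph hL hR, by simp⟩ hcont.continuousOn
  refine ⟨q, hq.1, fun q' hq' => ?_⟩
  rcases le_or_gt 0 (q'.1 * j - q'.2) with h | h
  · exact hmax ⟨hq', h⟩
  · exact h.le.trans hq.2

end Epigraph

section Calculus

theorem exists_contDiffAt_right_inverse {E : Type*} [NormedAddCommGroup E] [NormedSpace ℝ E]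
    [FiniteDimensional ℝ E] {n : WithTop ℕ∞} (hn : n ≠ 0) {f : E → E} {x : E}
    (hf : ContDiffAt ℝ n f x) (hinj : Function.Injective (fderiv ℝ f x)) :
    ∃ g : E → E, ContDiffAt ℝ n g (f x) ∧ g (f x) = x ∧ ∀ᶠ y in 𝓝 (f x), f (g y) = y := by
  have : CompleteSpace E := FiniteDimensional.complete ℝ E
  let e : E ≃L[ℝ] E :=
    (LinearEquiv.ofInjectiveEndo (fderiv ℝ f x : E →ₗ[ℝ] E) hinj).toContinuousLinearEquiv
  have hderiv : HasFDerivAt f (e : E →L[ℝ] E) x :=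
    (hf.differentiableAt hn).hasFDerivAt.congr_fderiv (by ext v; rfl)
  exact ⟨hf.localInverse hderiv hn, hf.to_localInverse hderiv hn,
    hf.localInverse_apply_image hderiv hn,
    (hf.hasStrictFDerivAt' hderiv hn).eventually_right_inverse⟩

theorem contDiffOn_cycleCgf :
    ContDiffOn ℝ (⊤ : ℕ∞) (cycleCgf βL βR) (openCycleDomain βL βR) := by
  have hlog : ContDiffOn ℝ (⊤ : ℕ∞) (fun q : ℝ × ℝ => Real.log (moment 1 q.1 q.2))
      (Set.Ioi 0 ×ˢ Set.Ioi 0) :=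
    (contDiffOn_moment 1).log fun q hq => (moment_one_pos hq.1 (le_of_lt hq.2)).ne'
  exact contDiffOn_const.add
    ((hlog.comp (f := fun q : ℝ × ℝ => (βL - q.1, q.2)) (by fun_prop)
        fun q hq => ⟨(pos_of_mem_cycleDomain (openCycleDomain_subset hq)).1, hq.2⟩).add
      (hlog.comp (f := fun q : ℝ × ℝ => (βR + q.1, q.2)) (by fun_prop)
        fun q hq => ⟨(pos_of_mem_cycleDomain (openCycleDomain_subset hq)).2.1, hq.2⟩))

theorem contDiffOn_cycleCurrent :
    ContDiffOn ℝ (⊤ : ℕ∞) (cycleCurrent βL βR) (openCycleDomain βL βR) := by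
  have left (a : ℤ) : ContDiffOn ℝ (⊤ : ℕ∞) (fun q => tiltedMean a (βL - q.1) q.2)
      (openCycleDomain βL βR) :=
    (contDiffOn_tiltedMean a).comp (f := fun q : ℝ × ℝ => (βL - q.1, q.2)) (by fun_prop)
      fun q hq => ⟨(pos_of_mem_cycleDomain (openCycleDomain_subset hq)).1, hq.2⟩
  have right (a : ℤ) : ContDiffOn ℝ (⊤ : ℕ∞) (fun q => tiltedMean a (βR + q.1) q.2)
      (openCycleDomain βL βR) :=
    (contDiffOn_tiltedMean a).comp (f := fun q : ℝ × ℝ => (βR + q.1, q.2)) (by fun_prop)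
      fun q hq => ⟨(pos_of_mem_cycleDomain (openCycleDomain_subset hq)).2.1, hq.2⟩
  exact (((left 2).sub (right 2)).div_const 2).div ((left (-1)).add (right (-1)))
    fun q hq => (cycleTime_pos (openCycleDomain_subset hq)).ne'

theorem hasFDerivAt_comp_const_sub_fst {f : ℝ × ℝ → ℝ} {β x y : ℝ} {q : ℝ × ℝ}
    (hf : HasFDerivAt f (linearForm x y) (β - q.1, q.2)) :
    HasFDerivAt (fun q => f (β - q.1, q.2)) (linearForm (-x) y) q := by
  have hg : HasFDerivAt (fun q : ℝ × ℝ => β - q.1) (linearForm (-1) 0) q :=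
    (hasFDerivAt_fst.const_sub β).congr_fderiv (by ext <;> simp [linearForm])
  exact (hasFDerivAt_linearForm_comp hf hg).congr_fderiv (by rw [mul_neg_one])

theorem hasFDerivAt_comp_const_add_fst {f : ℝ × ℝ → ℝ} {β x y : ℝ} {q : ℝ × ℝ}
    (hf : HasFDerivAt f (linearForm x y) (β + q.1, q.2)) :
    HasFDerivAt (fun q => f (β + q.1, q.2)) (linearForm x y) q := by
  have hg : HasFDerivAt (fun q : ℝ × ℝ => β + q.1) (linearForm 1 0) q :=
    (hasFDerivAt_fst.const_add β).congr_fderiv (by ext <;> simp [linearForm])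
  exact (hasFDerivAt_linearForm_comp hf hg).congr_fderiv (by rw [mul_one])

theorem hasFDerivAt_cycleCgf {q : ℝ × ℝ} (hq : q ∈ openCycleDomain βL βR) :
    HasFDerivAt (cycleCgf βL βR) (linearForm (cycleEnergy βL βR q) (-cycleTime βL βR q)) q := by
  obtain ⟨hbL, hbR, -⟩ := pos_of_mem_cycleDomain (openCycleDomain_subset hq)
  refine (((hasFDerivAt_comp_const_sub_fst (hasFDerivAt_log_moment hbL hq.2)).add
    (hasFDerivAt_comp_const_add_fst (hasFDerivAt_log_moment hbR hq.2))).const_add _).congr_fderiv ?_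
  ext <;> simp [linearForm, cycleEnergy, cycleTime] <;> ring

theorem hasFDerivAt_cycleEnergy {q : ℝ × ℝ} (hq : q ∈ openCycleDomain βL βR) :
    HasFDerivAt (cycleEnergy βL βR)
      (linearForm ((tiltedCov 2 2 (βL - q.1) q.2 + tiltedCov 2 2 (βR + q.1) q.2) / 4)
        ((tiltedCov 2 (-1) (βR + q.1) q.2 - tiltedCov 2 (-1) (βL - q.1) q.2) / 2)) q := by
  obtain ⟨hbL, hbR, -⟩ := pos_of_mem_cycleDomain (openCycleDomain_subset hq)
  refine (((hasFDerivAt_comp_const_sub_fst (hasFDerivAt_tiltedMean 2 hbL hq.2)).sub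
    (hasFDerivAt_comp_const_add_fst (hasFDerivAt_tiltedMean 2 hbR hq.2))).mul_const
      (2 : ℝ)⁻¹).congr_fderiv ?_
  ext <;> simp [linearForm] <;> ring

theorem hasFDerivAt_cycleTime {q : ℝ × ℝ} (hq : q ∈ openCycleDomain βL βR) :
    HasFDerivAt (cycleTime βL βR)
      (linearForm ((tiltedCov 2 (-1) (βL - q.1) q.2 - tiltedCov 2 (-1) (βR + q.1) q.2) / 2)
        (-(tiltedCov (-1) (-1) (βL - q.1) q.2 + tiltedCov (-1) (-1) (βR + q.1) q.2))) q := by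
  obtain ⟨hbL, hbR, -⟩ := pos_of_mem_cycleDomain (openCycleDomain_subset hq)
  refine ((hasFDerivAt_comp_const_sub_fst (hasFDerivAt_tiltedMean (-1) hbL hq.2)).add
    (hasFDerivAt_comp_const_add_fst (hasFDerivAt_tiltedMean (-1) hbR hq.2))).congr_fderiv ?_
  ext <;> simp [linearForm, tiltedCov_comm (-1) 2] <;> ring

/- Since the exponent `λ ΔJ - θ Δt` is linear in `(λ, θ)`, the derivative of
`cycleEnergy - j * cycleTime` along `(1, j)` is the tilted variance of `ΔJ - j Δt`. -/
theorem exists_hasFDerivAt_cycleCurrent {q : ℝ × ℝ} (hq : q ∈ openCycleDomain βL βR) :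
    ∃ x y : ℝ, HasFDerivAt (cycleCurrent βL βR) (linearForm x y) q ∧
      0 < x + y * cycleCurrent βL βR q := by
  obtain ⟨hbL, hbR, -⟩ := pos_of_mem_cycleDomain (openCycleDomain_subset hq)
  have htime := cycleTime_pos (openCycleDomain_subset hq)
  refine ⟨_, _, hasFDerivAt_linearForm_div (hasFDerivAt_cycleEnergy hq) (hasFDerivAt_cycleTime hq)
    htime.ne', ?_⟩
  change 0 < (_ - cycleCurrent βL βR q * _) / _ +
    (_ - cycleCurrent βL βR q * _) / _ * cycleCurrent βL βR q
  generalize cycleCurrent βL βR q = j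
  have variance_pos := add_pos (tiltedCov_quadratic_pos (α := 1 / 2) (by norm_num) (-j) hbL hq.2)
    (tiltedCov_quadratic_pos (α := 1 / 2) (by norm_num) j hbR hq.2)
  refine (div_pos variance_pos htime).trans_eq ?_
  ring

end Calculus

section Maximizer

theorem epigraph_mem_nhds (hL : 0 < βL) (hR : 0 < βR) {q : ℝ × ℝ}
    (hq : q ∈ openCycleDomain βL βR) (hneg : cycleCgf βL βR q < 0) : epigraph βL βR ∈ 𝓝 q := by
  have hnhds := isOpen_openCycleDomain.mem_nhds hq
  filter_upwards [hnhds, (hasFDerivAt_cycleCgf hq).continuousAt.eventually (gt_mem_nhds hneg)]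
    with q' hq' hneg'
  exact (mem_epigraph_iff hL hR (openCycleDomain_subset hq')).2 hneg'.le

theorem hasStrictFDerivAt_fst_mul_sub_snd (j : ℝ) (q : ℝ × ℝ) :
    HasStrictFDerivAt (fun q : ℝ × ℝ => q.1 * j - q.2) (linearForm j (-1)) q :=
  ((hasStrictFDerivAt_fst.mul_const j).sub hasStrictFDerivAt_snd).congr_fderiv
    (by ext <;> simp [linearForm])

theorem cycleCgf_eq_zero_of_isMaxOn (hL : 0 < βL) (hR : 0 < βR) {q : ℝ × ℝ} {j : ℝ}
    (hq : q ∈ openCycleDomain βL βR) (hqe : q ∈ epigraph βL βR)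
    (hmax : IsMaxOn (fun q => q.1 * j - q.2) (epigraph βL βR) q) : cycleCgf βL βR q = 0 := by
  by_contra hne
  have hneg := lt_of_le_of_ne ((mem_epigraph_iff hL hR (openCycleDomain_subset hq)).1 hqe) hne
  have hcritical := (hmax.isLocalMax (epigraph_mem_nhds hL hR hq hneg)).hasFDerivAt_eq_zero
    (hasStrictFDerivAt_fst_mul_sub_snd j q).hasFDerivAt
  simpa [linearForm] using DFunLike.congr_fun hcritical (0, 1)

theorem cycleCurrent_eq_of_isMaxOn (hL : 0 < βL) (hR : 0 < βR) {q : ℝ × ℝ} {j : ℝ}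
    (hq : q ∈ openCycleDomain βL βR) (hqe : q ∈ epigraph βL βR)
    (hmax : IsMaxOn (fun q => q.1 * j - q.2) (epigraph βL βR) q) : cycleCurrent βL βR q = j := by
  have hcgf := cycleCgf_eq_zero_of_isMaxOn hL hR hq hqe hmax
  have hnhds := isOpen_openCycleDomain.mem_nhds hq
  have hextr : IsLocalMaxOn (fun q => q.1 * j - q.2)
      {q' | cycleCgf βL βR q' = cycleCgf βL βR q} q := by
    filter_upwards [nhdsWithin_le_nhds hnhds, self_mem_nhdsWithin] with q' hq' hlevel
    exact hmax ((mem_epigraph_iff hL hR (openCycleDomain_subset hq')).2 (hlevel.trans hcgf).le)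
  have hstrict := (contDiffOn_cycleCgf.contDiffAt hnhds).hasStrictFDerivAt'
    (hasFDerivAt_cycleCgf hq) (by simp)
  obtain ⟨a, b, hab, hlagrange⟩ := IsLocalExtrOn.exists_multipliers_of_hasStrictFDerivAt_1d
    hextr.isExtr hstrict (hasStrictFDerivAt_fst_mul_sub_snd j q)
  have hfst : a * cycleEnergy βL βR q + b * j = 0 := by
    simpa [linearForm] using DFunLike.congr_fun hlagrange (1, 0)
  have hsnd : b = -(a * cycleTime βL βR q) := by
    simpa [linearForm, eq_comm, add_eq_zero_iff_eq_neg] using DFunLike.congr_fun hlagrange (0, 1)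
  have ha : a ≠ 0 := by
    rintro rfl
    simp [hsnd] at hab
  rw [cycleCurrent, div_eq_iff (cycleTime_pos (openCycleDomain_subset hq)).ne']
  refine mul_left_cancel₀ ha ?_
  linear_combination hfst - j * hsnd

theorem exists_isMaxOn_openCycleDomain (hL : 0 < βL) (hLR : βL ≤ βR) {j : ℝ}
    (hj : jStar βL βR < j) : ∃ q ∈ openCycleDomain βL βR, q ∈ epigraph βL βR ∧
      IsMaxOn (fun q => q.1 * j - q.2) (epigraph βL βR) q := by
  have hR := hL.trans_le hLR
  obtain ⟨q, hq, hmax⟩ := exists_isMaxOn_epigraph hL hR j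
  obtain ⟨q₁, hq₁, hpos₁⟩ := exists_mem_epigraph_lt hL hLR hj
  have hpos : 0 < q.1 * j - q.2 := hpos₁.trans_le (hmax hq₁)
  have hdom := epigraph_subset_cycleDomain hL hR hq
  obtain ⟨hbL, hbR, hθ⟩ := pos_of_mem_cycleDomain hdom
  have hfst : 0 < q.1 := by
    have := mul_jStar_le_of_mem_epigraph hL hR hq
    exact pos_of_mul_pos_left (b := j - jStar βL βR) (by linarith) (sub_nonneg.2 hj.le)
  refine ⟨q, ⟨hdom.1, hθ.lt_of_ne fun hzero => ?_⟩, hq, hmax⟩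
  have hcgf := (mem_epigraph_iff hL hR hdom).1 hq
  rw [cycleCgf, ← hzero, moment_one_zero hbL, moment_one_zero hbR,
    ← Real.log_mul (by positivity) (by positivity), ← Real.log_mul (by positivity) (by positivity),
    Real.log_nonpos_iff (by positivity), one_div_mul_one_div, mul_one_div,
    div_le_one (by positivity)] at hcgf
  nlinarith

end Maximizer

/-- The support function `j ↦ sup {λ j - θ | (λ, θ) ∈ epigraph βL βR}`, which is the Legendre
transform of the function whose epigraph is `epigraph βL βR`. -/
def rate (βL βR j : ℝ) : ℝ := sSup ((fun q => q.1 * j - q.2) '' epigraph βL βR)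

section Rate

theorem rate_eq_of_isMaxOn {j : ℝ} {q : ℝ × ℝ} (hq : q ∈ epigraph βL βR)
    (hmax : IsMaxOn (fun q => q.1 * j - q.2) (epigraph βL βR) q) :
    rate βL βR j = q.1 * j - q.2 :=
  IsGreatest.csSup_eq ⟨⟨q, hq, rfl⟩, Set.forall_mem_image.2 hmax⟩

theorem le_rate (hL : 0 < βL) (hR : 0 < βR) {q : ℝ × ℝ} (hq : q ∈ epigraph βL βR) (j : ℝ) :
    q.1 * j - q.2 ≤ rate βL βR j := by
  obtain ⟨q', hq', hmax⟩ := exists_isMaxOn_epigraph hL hR j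
  rw [rate_eq_of_isMaxOn hq' hmax]
  exact hmax hq

theorem rate_nonneg (hL : 0 < βL) (hR : 0 < βR) (j : ℝ) : 0 ≤ rate βL βR j := by
  simpa using le_rate hL hR (zero_mem_epigraph hL hR) j

theorem convexOn_rate (hL : 0 < βL) (hR : 0 < βR) : ConvexOn ℝ Set.univ (rate βL βR) := by
  refine ⟨convex_univ, fun x _ y _ a b ha hb hab => ?_⟩
  obtain ⟨q, hq, hmax⟩ := exists_isMaxOn_epigraph hL hR (a • x + b • y)
  calc rate βL βR (a • x + b • y) = q.1 * (a • x + b • y) - (a + b) * q.2 := by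
        rw [rate_eq_of_isMaxOn hq hmax, hab, one_mul]
    _ = a * (q.1 * x - q.2) + b * (q.1 * y - q.2) := by
        simp only [smul_eq_mul]
        ring
    _ ≤ a • rate βL βR x + b • rate βL βR y :=
        add_le_add (mul_le_mul_of_nonneg_left (le_rate hL hR hq x) ha)
          (mul_le_mul_of_nonneg_left (le_rate hL hR hq y) hb)

theorem rate_reflect (hL : 0 < βL) (hR : 0 < βR) (j : ℝ) :
    rate βL βR j = (βL - βR) * j + rate βL βR (-j) := by
  have rate_le (j : ℝ) : rate βL βR j ≤ (βL - βR) * j + rate βL βR (-j) := by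
    obtain ⟨q, hq, hmax⟩ := exists_isMaxOn_epigraph hL hR j
    have hle := le_rate hL hR (reflect_mem_epigraph hq) (-j)
    rw [rate_eq_of_isMaxOn hq hmax]
    linear_combination hle
  refine (rate_le j).antisymm ?_
  have hle := rate_le (-j)
  rw [neg_neg] at hle
  linear_combination hle

theorem rate_eq_zero (hL : 0 < βL) (hR : 0 < βR) {j : ℝ} (hj : j ∈ Set.Icc 0 (jStar βL βR)) :
    rate βL βR j = 0 := by
  refine le_antisymm ?_ (rate_nonneg hL hR j)
  obtain ⟨q, hq, hmax⟩ := exists_isMaxOn_epigraph hL hR j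
  rw [rate_eq_of_isMaxOn hq hmax, sub_nonpos]
  rcases le_total q.1 0 with hneg | hpos
  · exact (mul_nonpos_of_nonpos_of_nonneg hneg hj.1).trans (epigraph_subset_cycleDomain hL hR hq).2
  · exact (mul_le_mul_of_nonneg_left hj.2 hpos).trans (mul_jStar_le_of_mem_epigraph hL hR hq)

theorem rate_pos (hL : 0 < βL) (hLR : βL ≤ βR) {j : ℝ} (hj : jStar βL βR < j) :
    0 < rate βL βR j := by
  obtain ⟨q, hq, hpos⟩ := exists_mem_epigraph_lt hL hLR hj
  exact hpos.trans_le (le_rate hL (hL.trans_le hLR) hq j)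

theorem injective_fderiv_cycleCgf_cycleCurrent {q : ℝ × ℝ} (hq : q ∈ openCycleDomain βL βR) :
    Function.Injective (fderiv ℝ (fun q => (cycleCgf βL βR q, cycleCurrent βL βR q)) q) := by
  obtain ⟨x, y, hcurrent, hpos⟩ := exists_hasFDerivAt_cycleCurrent hq
  have htime := cycleTime_pos (openCycleDomain_subset hq)
  rw [((hasFDerivAt_cycleCgf hq).prodMk hcurrent).fderiv, injective_iff_map_eq_zero]
  intro d hd
  obtain ⟨hcgf, hcur⟩ := Prod.ext_iff.1 hd
  replace hcgf : d.2 = cycleCurrent βL βR q * d.1 := by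
    rw [cycleCurrent, div_mul_eq_mul_div, eq_div_iff htime.ne']
    rw [ContinuousLinearMap.prod_apply, linearForm_apply, Prod.fst_zero] at hcgf
    linear_combination -hcgf
  have hfst : d.1 = 0 := by
    refine (mul_eq_zero.1 ?_).resolve_left hpos.ne'
    rw [ContinuousLinearMap.prod_apply, linearForm_apply, linearForm_apply, Prod.snd_zero] at hcur
    linear_combination hcur - y * hcgf
  exact Prod.ext hfst (by rw [hcgf, hfst, mul_zero, Prod.snd_zero])

theorem contDiffAt_rate (hL : 0 < βL) (hLR : βL ≤ βR) {j : ℝ} (hj : jStar βL βR < j) :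
    ContDiffAt ℝ (⊤ : ℕ∞) (rate βL βR) j := by
  have hR := hL.trans_le hLR
  obtain ⟨q, hq, hqe, hmax⟩ := exists_isMaxOn_openCycleDomain hL hLR hj
  have hnhds := isOpen_openCycleDomain.mem_nhds hq
  obtain ⟨g, hg, hgq, hright⟩ := exists_contDiffAt_right_inverse (by simp)
    ((contDiffOn_cycleCgf.contDiffAt hnhds).prodMk (contDiffOn_cycleCurrent.contDiffAt hnhds))
    (injective_fderiv_cycleCgf_cycleCurrent hq)
  rw [cycleCgf_eq_zero_of_isMaxOn hL hR hq hqe hmax, cycleCurrent_eq_of_isMaxOn hL hR hq hqe hmax]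
    at hg hgq hright
  have hline : ContDiffAt ℝ (⊤ : ℕ∞) (fun x : ℝ => ((0 : ℝ), x)) j := by fun_prop
  have hcurve : ContDiffAt ℝ (⊤ : ℕ∞) (fun x => g (0, x)) j := hg.comp j hline
  have hrate : ∀ᶠ x in 𝓝 j, rate βL βR x = (g (0, x)).1 * x - (g (0, x)).2 := by
    filter_upwards [hline.continuousAt.eventually hright,
      hcurve.continuousAt.eventually_mem (by simpa only [hgq] using hnhds)] with x hx hmem
    obtain ⟨hcgf, hcur⟩ := Prod.ext_iff.1 hx
    have hdom := openCycleDomain_subset hmem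
    have hmax' := isMaxOn_epigraph_of_cycleCgf_eq_zero hL hR hdom hcgf
    rw [show cycleCurrent βL βR (g (0, x)) = x from hcur] at hmax'
    exact rate_eq_of_isMaxOn ((mem_epigraph_iff hL hR hdom).2 hcgf.le) hmax'
  exact ((hcurve.fst.mul contDiffAt_id).sub hcurve.snd).congr_of_eventuallyEq hrate

theorem contDiffOn_rate (hL : 0 < βL) (hLR : βL ≤ βR) :
    ContDiffOn ℝ (⊤ : ℕ∞) (rate βL βR) (Set.Icc (-jStar βL βR) (jStar βL βR))ᶜ := by
  intro j hj
  refine ContDiffAt.contDiffWithinAt ?_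
  rw [Set.mem_compl_iff, Set.mem_Icc, not_and_or, not_le, not_le] at hj
  rcases hj with hj | hj
  · have hrate := contDiffAt_rate hL hLR (lt_neg_of_lt_neg hj)
    rw [funext (rate_reflect hL (hL.trans_le hLR))]
    exact (contDiffAt_const.mul contDiffAt_id).add (hrate.comp j contDiffAt_id.neg)
  · exact contDiffAt_rate hL hLR hj

theorem rate_lt_of_jStar_lt (hL : 0 < βL) (hLR : βL ≤ βR) {x y a b : ℝ} (hxy : x ≠ y)
    (ha : 0 < a) (hb : 0 < b) (hab : a + b = 1) (hj : jStar βL βR < a * x + b * y) :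
    rate βL βR (a * x + b * y) < a * rate βL βR x + b * rate βL βR y := by
  have hR := hL.trans_le hLR
  obtain ⟨q, hq, hqe, hmax⟩ := exists_isMaxOn_openCycleDomain hL hLR hj
  have lt_rate {z : ℝ} (hz : a * x + b * y ≠ z) : q.1 * z - q.2 < rate βL βR z := by
    refine (le_rate hL hR hqe z).lt_of_ne fun heq => hz ?_
    rw [← cycleCurrent_eq_of_isMaxOn hL hR hq hqe hmax]
    exact cycleCurrent_eq_of_isMaxOn hL hR hq hqe fun q' hq' =>
      (le_rate hL hR hq' z).trans_eq heq.symm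
  have hx : a * x + b * y ≠ x := fun h => hxy (mul_left_cancel₀ hb.ne'
    (by linear_combination x * hab - h))
  have hy : a * x + b * y ≠ y := fun h => hxy (mul_left_cancel₀ ha.ne'
    (by linear_combination h - y * hab))
  calc rate βL βR (a * x + b * y) = q.1 * (a * x + b * y) - (a + b) * q.2 := by
        rw [rate_eq_of_isMaxOn hqe hmax, hab, one_mul]
    _ = a * (q.1 * x - q.2) + b * (q.1 * y - q.2) := by ring
    _ < a * rate βL βR x + b * rate βL βR y :=
        add_lt_add (mul_lt_mul_of_pos_left (lt_rate hx) ha) (mul_lt_mul_of_pos_left (lt_rate hy) hb)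

theorem rate_lt_of_nonneg (hL : 0 < βL) (hLR : βL ≤ βR) {x y a b : ℝ} (hxy : x ≠ y)
    (hx : x ∈ (Set.Icc (-jStar βL βR) (jStar βL βR))ᶜ)
    (hy : y ∈ (Set.Icc (-jStar βL βR) (jStar βL βR))ᶜ)
    (ha : 0 < a) (hb : 0 < b) (hab : a + b = 1) (hnonneg : 0 ≤ a * x + b * y) :
    rate βL βR (a * x + b * y) < a * rate βL βR x + b * rate βL βR y := by
  have hR := hL.trans_le hLR
  rcases lt_or_ge (jStar βL βR) (a * x + b * y) with hlt | hle
  · exact rate_lt_of_jStar_lt hL hLR hxy ha hb hab hlt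
  · rw [rate_eq_zero hL hR ⟨hnonneg, hle⟩]
    have hjStar := jStar_nonneg hL hLR
    have hx₀ := mul_nonneg ha.le (rate_nonneg hL hR x)
    have hy₀ := mul_nonneg hb.le (rate_nonneg hL hR y)
    rw [Set.mem_compl_iff, Set.mem_Icc, not_and_or, not_le, not_le] at hx hy
    rcases hx with hx | hx
    · rcases hy with hy | hy
      · nlinarith
      · exact add_pos_of_nonneg_of_pos hx₀ (mul_pos hb (rate_pos hL hLR hy))
    · exact add_pos_of_pos_of_nonneg (mul_pos ha (rate_pos hL hLR hx)) hy₀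

theorem rate_lt (hL : 0 < βL) (hLR : βL ≤ βR) {x y a b : ℝ} (hxy : x ≠ y)
    (hx : x ∈ (Set.Icc (-jStar βL βR) (jStar βL βR))ᶜ)
    (hy : y ∈ (Set.Icc (-jStar βL βR) (jStar βL βR))ᶜ)
    (ha : 0 < a) (hb : 0 < b) (hab : a + b = 1) :
    rate βL βR (a * x + b * y) < a * rate βL βR x + b * rate βL βR y := by
  have hR := hL.trans_le hLR
  rcases le_total 0 (a * x + b * y) with hnonneg | hnonpos
  · exact rate_lt_of_nonneg hL hLR hxy hx hy ha hb hab hnonneg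
  · have neg_mem {z : ℝ} (hz : z ∈ (Set.Icc (-jStar βL βR) (jStar βL βR))ᶜ) :
        -z ∈ (Set.Icc (-jStar βL βR) (jStar βL βR))ᶜ :=
      fun h => hz ⟨neg_le_neg_iff.1 (by simpa using h.2), neg_le_neg_iff.1 h.1⟩
    have hlt := rate_lt_of_nonneg hL hLR (neg_injective.ne hxy) (neg_mem hx) (neg_mem hy) ha hb hab
      (by linarith)
    rw [show a * -x + b * -y = -(a * x + b * y) by ring] at hlt
    rw [rate_reflect hL hR (a * x + b * y), rate_reflect hL hR x, rate_reflect hL hR y]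
    linear_combination hlt

end Rate

section Speeds

/-- The sequence with first term `x` followed by the terms of `v`. -/
def consSeq {α : Type*} (x : α) (v : ℕ → α) : ℕ → α
  | 0 => x
  | n + 1 => v n

theorem measurable_consSeq {α : Type*} [MeasurableSpace α] :
    Measurable fun z : α × (ℕ → α) => consSeq z.1 z.2 := by
  refine measurable_pi_iff.2 fun n => ?_
  cases n with
  | zero => exact measurable_fst
  | succ n => exact (measurable_pi_apply n).comp measurable_snd

theorem consSeq_preimage_pi_range {α : Type*} (t : ℕ → Set α) (n : ℕ) :
    (fun z : α × (ℕ → α) => consSeq z.1 z.2) ⁻¹' (Finset.range (n + 1) : Set ℕ).pi t =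
      t 0 ×ˢ (Finset.range n : Set ℕ).pi fun i => t (i + 1) := by
  ext z
  simp only [Set.mem_preimage, Set.mem_pi, Finset.mem_coe, Finset.mem_range, Set.mem_prod]
  exact ⟨fun h => ⟨h 0 n.succ_pos, fun i hi => h (i + 1) (Nat.succ_lt_succ hi)⟩,
    fun h i hi => match i with
      | 0 => h.1
      | i + 1 => h.2 i (Nat.lt_of_succ_lt_succ hi)⟩

theorem eq_infinitePi_of_pi_range {α : ℕ → Type*} [∀ i, MeasurableSpace (α i)]
    {μ : ∀ i, Measure (α i)} [∀ i, IsProbabilityMeasure (μ i)] {ν : Measure (∀ i, α i)}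
    (hν : ∀ n (t : ∀ i, Set (α i)), (∀ i, MeasurableSet (t i)) →
      ν ((Finset.range n : Set ℕ).pi t) = ∏ i ∈ Finset.range n, μ i (t i)) :
    ν = Measure.infinitePi μ := by
  classical
  refine Measure.eq_infinitePi _ fun s t ht => ?_
  obtain ⟨n, hn⟩ := s.exists_nat_subset_range
  have hpi : (s : Set ℕ).pi t =
      (Finset.range n : Set ℕ).pi fun i => if i ∈ s then t i else Set.univ := by
    ext u
    simp only [Set.mem_pi, Finset.mem_coe]
    refine ⟨fun h i _ => ?_, fun h i hi => by simpa [hi] using h i (hn hi)⟩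
    split_ifs with hi
    exacts [h i hi, Set.mem_univ _]
  rw [hpi, hν n _ fun i => by split_ifs <;> simp [ht], ← Finset.prod_subset hn]
  · exact Finset.prod_congr rfl fun i hi => by rw [if_pos hi]
  · exact fun i _ hi => by rw [if_neg hi, measure_univ]

theorem map_consSeq_prod_infinitePi {α : Type*} [MeasurableSpace α] (μ : ℕ → Measure α)
    [∀ i, IsProbabilityMeasure (μ i)] :
    ((μ 0).prod (Measure.infinitePi fun i => μ (i + 1))).map (fun z => consSeq z.1 z.2) =
      Measure.infinitePi μ := by
  refine eq_infinitePi_of_pi_range fun n t ht => ?_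
  rw [Measure.map_apply measurable_consSeq
    (MeasurableSet.pi (Finset.countable_toSet _) fun i _ => ht i)]
  cases n with
  | zero => simp
  | succ n =>
    rw [consSeq_preimage_pi_range, Measure.prod_prod,
      Measure.infinitePi_pi _ fun i _ => ht (i + 1), Finset.prod_range_succ', mul_comm]

theorem wallSign_zero (p : ℝ) : wallSign p 0 = Real.sign p := by simp [wallSign]

theorem wallSign_succ (p : ℝ) (k : ℕ) : wallSign p (k + 1) = wallSign (-p) k := by
  rw [wallSign, wallSign, pow_succ, Real.sign_neg, mul_assoc, neg_one_mul]

theorem wallSign_sq {p : ℝ} (hp : p ≠ 0) (k : ℕ) : wallSign p k ^ 2 = 1 := by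
  rw [wallSign, mul_pow, ← pow_mul, mul_comm k, pow_mul]
  rcases Real.sign_apply_eq_of_ne_zero p hp with h | h <;> simp [h]

theorem wallBeta_pos (hL : 0 < βL) (hR : 0 < βR) (s : ℝ) : 0 < wallBeta βL βR s := by
  rw [wallBeta]
  split_ifs <;> assumption

/-- The law of the speed at which the particle leaves the wall it hits with momentum `p`. -/
def emissionLaw (βL βR p : ℝ) : Measure ℝ := wallLaw (wallBeta βL βR (Real.sign p))

theorem isProbabilityMeasure_emissionLaw (hL : 0 < βL) (hR : 0 < βR) (p : ℝ) :
    IsProbabilityMeasure (emissionLaw βL βR p) :=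
  isProbabilityMeasure_wallLaw (wallBeta_pos hL hR _)

theorem isProbabilityMeasure_speedLaw (hL : 0 < βL) (hR : 0 < βR) (p : ℝ) :
    IsProbabilityMeasure (speedLaw βL βR p) := by
  have (k : ℕ) := isProbabilityMeasure_wallLaw (wallBeta_pos hL hR (wallSign p k))
  unfold speedLaw
  infer_instance

theorem map_consSeq_speedLaw (hL : 0 < βL) (hR : 0 < βR) (p : ℝ) :
    ((emissionLaw βL βR p).prod (speedLaw βL βR (-p))).map (fun z => consSeq z.1 z.2) =
      speedLaw βL βR p := by
  have (k : ℕ) := isProbabilityMeasure_wallLaw (wallBeta_pos hL hR (wallSign p k))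
  have hmap := map_consSeq_prod_infinitePi fun k => wallLaw (wallBeta βL βR (wallSign p k))
  simp only [wallSign_zero, wallSign_succ] at hmap
  exact hmap

theorem lintegral_speedLaw (hL : 0 < βL) (hR : 0 < βR) (p : ℝ) {f : (ℕ → ℝ) → ENNReal}
    (hf : Measurable f) : ∫⁻ u, f u ∂speedLaw βL βR p =
      ∫⁻ x, ∫⁻ v, f (consSeq x v) ∂speedLaw βL βR (-p) ∂emissionLaw βL βR p := by
  have := isProbabilityMeasure_speedLaw hL hR (-p)
  rw [← map_consSeq_speedLaw hL hR p, lintegral_map hf measurable_consSeq]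
  exact lintegral_prod _ (hf.comp measurable_consSeq).aemeasurable

theorem wallLaw_eq_withDensity_restrict (β : ℝ) :
    wallLaw β = (volume.restrict (Set.Ioi 0)).withDensity
      fun x => ENNReal.ofReal (β * x * Real.exp (-β * x ^ 2 / 2)) := by
  rw [wallLaw, ← withDensity_indicator measurableSet_Ioi]
  congr 1
  ext x
  by_cases hx : 0 < x <;> simp [wallDensity, hx]

theorem lintegral_wallLaw (β : ℝ) {f : ℝ → ENNReal} (hf : Measurable f) :
    ∫⁻ x, f x ∂wallLaw β =
      ∫⁻ x in Set.Ioi (0 : ℝ), ENNReal.ofReal (β * x * Real.exp (-β * x ^ 2 / 2)) * f x := by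
  rw [wallLaw_eq_withDensity_restrict]
  exact lintegral_withDensity_eq_lintegral_mul _ (by fun_prop) hf

theorem ae_pos_wallLaw (β : ℝ) : ∀ᵐ x ∂wallLaw β, 0 < x := by
  rw [wallLaw_eq_withDensity_restrict]
  exact (withDensity_absolutelyContinuous _ _).ae_le (ae_restrict_mem measurableSet_Ioi)

theorem wallLaw_Ioo_pos {β : ℝ} (hβ : 0 < β) {c : ℝ} (hc : 0 < c) :
    0 < wallLaw β (Set.Ioo 0 c) := by
  have hac : volume.restrict (Set.Ioi 0) ≪ wallLaw β := by
    rw [wallLaw_eq_withDensity_restrict]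
    refine withDensity_absolutelyContinuous' (by fun_prop) ?_
    filter_upwards [ae_restrict_mem measurableSet_Ioi] with x (hx : 0 < x)
    exact (ENNReal.ofReal_pos.2 (by positivity)).ne'
  refine pos_iff_ne_zero.2 fun hzero => hc.not_ge ?_
  have hvol := hac hzero
  rwa [Measure.restrict_apply measurableSet_Ioo,
    Set.inter_eq_left.2 Set.Ioo_subset_Ioi_self, Real.volume_Ioo, sub_zero,
    ENNReal.ofReal_eq_zero] at hvol

theorem ae_pos_speedLaw (hL : 0 < βL) (hR : 0 < βR) (p : ℝ) :
    ∀ᵐ u ∂speedLaw βL βR p, ∀ k, 0 < u k := by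
  have (k : ℕ) := isProbabilityMeasure_wallLaw (wallBeta_pos hL hR (wallSign p k))
  exact ae_all_iff.2 fun k => (measurePreserving_eval_infinitePi
    (fun k => wallLaw (wallBeta βL βR (wallSign p k))) k).quasiMeasurePreserving.ae
      (ae_pos_wallLaw _)

end Speeds

section FlightMass

/-- The exponential `e^{λ ΔJ - θ Δt}` of the energy `ΔJ` exchanged and of the time `Δt` elapsed
during the flight at speed `x` of a particle leaving the wall it has hit with momentum `p`. -/
def flightWeight (l θ p x : ℝ) : ENNReal :=
  ENNReal.ofReal (Real.exp (l / 2 * (x ^ 2 * -Real.sign p) - θ * (1 / x)))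

@[fun_prop]
theorem measurable_flightWeight (l θ p : ℝ) : Measurable (flightWeight l θ p) := by
  unfold flightWeight
  fun_prop

/-- The exponential moment of one flight. -/
def flightMass (βL βR l θ p : ℝ) : ENNReal := ∫⁻ x, flightWeight l θ p x ∂emissionLaw βL βR p

theorem lintegral_exp_wallLaw {β : ℝ} (hβ : 0 < β) (a θ : ℝ) :
    ∫⁻ x, ENNReal.ofReal (Real.exp (a / 2 * x ^ 2 - θ * (1 / x))) ∂wallLaw β =
      ENNReal.ofReal β * mass (β - a) θ := by
  rw [lintegral_wallLaw β (by fun_prop), mass, ← lintegral_const_mul' _ _ ENNReal.ofReal_ne_top]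
  refine setLIntegral_congr_fun measurableSet_Ioi fun x (hx : 0 < x) => ?_
  rw [← ENNReal.ofReal_mul (by positivity), ← ENNReal.ofReal_mul hβ.le, mul_assoc,
    mul_assoc, ← Real.exp_add, momentKernel, zpow_one]
  ring_nf

theorem flightMass_of_neg (hL : 0 < βL) (l θ : ℝ) {p : ℝ} (hp : p < 0) :
    flightMass βL βR l θ p = ENNReal.ofReal βL * mass (βL - l) θ := by
  rw [← lintegral_exp_wallLaw hL, flightMass, emissionLaw, wallBeta, Real.sign_of_neg hp,
    if_pos neg_one_lt_zero]
  simp only [flightWeight, Real.sign_of_neg hp, neg_neg, mul_one]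

theorem flightMass_of_pos (hR : 0 < βR) (l θ : ℝ) {p : ℝ} (hp : 0 < p) :
    flightMass βL βR l θ p = ENNReal.ofReal βR * mass (βR + l) θ := by
  rw [← sub_neg_eq_add, ← lintegral_exp_wallLaw hR, flightMass, emissionLaw, wallBeta,
    Real.sign_of_pos hp, if_neg zero_lt_one.not_gt]
  simp only [flightWeight, Real.sign_of_pos hp, mul_neg, mul_one, neg_div, neg_mul]

theorem flightMass_mul_flightMass_neg (hL : 0 < βL) (hR : 0 < βR) (l θ : ℝ) {p : ℝ} (hp : p ≠ 0) :
    flightMass βL βR l θ p * flightMass βL βR l θ (-p) = cycleMass βL βR l θ := by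
  rw [cycleMass, ENNReal.ofReal_mul hL.le]
  rcases hp.lt_or_gt with hneg | hpos
  · rw [flightMass_of_neg hL l θ hneg, flightMass_of_pos hR l θ (neg_pos.2 hneg)]
    ring
  · rw [flightMass_of_pos hR l θ hpos, flightMass_of_neg hL l θ (neg_neg_iff_pos.2 hpos)]
    ring

theorem flightMass_pos (hL : 0 < βL) (hR : 0 < βR) (l θ : ℝ) {p : ℝ} (hp : p ≠ 0) :
    0 < flightMass βL βR l θ p := by
  rcases hp.lt_or_gt with hneg | hpos
  · rw [flightMass_of_neg hL l θ hneg]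
    exact ENNReal.mul_pos (by simpa using hL) (mass_pos _ _).ne'
  · rw [flightMass_of_pos hR l θ hpos]
    exact ENNReal.mul_pos (by simpa using hR) (mass_pos _ _).ne'

end FlightMass

section Flights

/-- The time spent in the first `n` flights. -/
def flightTime (n : ℕ) (u : ℕ → ℝ) : ℝ := ∑ i ∈ Finset.range n, 1 / u i

/-- The energy exchanged in the first `n` flights. -/
def flightEnergy (p : ℝ) (n : ℕ) (u : ℕ → ℝ) : ℝ :=
  1 / 2 * ∑ k ∈ Finset.range n, u k ^ 2 * wallSign p (k + 1)

/-- The exponential `e^{λ ΔJ - θ Δt}` of the energy `ΔJ` exchanged and of the time `Δt` elapsed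
during the first `n` flights of a particle leaving the wall it has hit with momentum `p`. -/
def flightsWeight (l θ p : ℝ) (n : ℕ) (u : ℕ → ℝ) : ENNReal :=
  ENNReal.ofReal (Real.exp (l * flightEnergy p n u - θ * flightTime n u))

/-- The exponential moment of the first `n` flights. -/
def flightsMass (βL βR l θ p : ℝ) (n : ℕ) : ENNReal :=
  ∫⁻ u, flightsWeight l θ p n u ∂speedLaw βL βR p

theorem flightTime_zero (u : ℕ → ℝ) : flightTime 0 u = 0 := Finset.sum_range_zero _

theorem flightTime_consSeq (n : ℕ) (x : ℝ) (v : ℕ → ℝ) :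
    flightTime (n + 1) (consSeq x v) = flightTime n v + 1 / x :=
  Finset.sum_range_succ' _ n

theorem flightsWeight_zero (l θ p : ℝ) (u : ℕ → ℝ) : flightsWeight l θ p 0 u = 1 := by
  simp [flightsWeight, flightEnergy, flightTime_zero]

theorem flightsWeight_consSeq (l θ p : ℝ) (n : ℕ) (x : ℝ) (v : ℕ → ℝ) :
    flightsWeight l θ p (n + 1) (consSeq x v) =
      flightWeight l θ p x * flightsWeight l θ (-p) n v := by
  have henergy : flightEnergy p (n + 1) (consSeq x v) =
      flightEnergy (-p) n v + 1 / 2 * (x ^ 2 * -Real.sign p) := by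
    simp only [flightEnergy, Finset.sum_range_succ', consSeq, wallSign_succ, wallSign_zero,
      Real.sign_neg, mul_add]
  rw [flightsWeight, flightsWeight, flightWeight, ← ENNReal.ofReal_mul (Real.exp_pos _).le,
    ← Real.exp_add, henergy, flightTime_consSeq]
  ring_nf

@[fun_prop]
theorem measurable_flightTime (n : ℕ) : Measurable (flightTime n) := by
  unfold flightTime
  fun_prop

@[fun_prop]
theorem measurable_flightsWeight (l θ p : ℝ) (n : ℕ) : Measurable (flightsWeight l θ p n) := by
  unfold flightsWeight flightEnergy
  fun_prop

theorem flightsMass_zero (hL : 0 < βL) (hR : 0 < βR) (l θ p : ℝ) :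
    flightsMass βL βR l θ p 0 = 1 := by
  have := isProbabilityMeasure_speedLaw hL hR p
  simp [flightsMass, flightsWeight_zero]

theorem flightsMass_succ (hL : 0 < βL) (hR : 0 < βR) (l θ p : ℝ) (n : ℕ) :
    flightsMass βL βR l θ p (n + 1) =
      flightMass βL βR l θ p * flightsMass βL βR l θ (-p) n := by
  rw [flightsMass, lintegral_speedLaw hL hR p (by fun_prop), flightMass,
    ← lintegral_mul_const _ (by fun_prop)]
  refine lintegral_congr fun x => ?_
  simp only [flightsWeight_consSeq]
  exact lintegral_const_mul _ (by fun_prop)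

theorem flightsMass_two_mul (hL : 0 < βL) (hR : 0 < βR) (l θ : ℝ) {p : ℝ} (hp : p ≠ 0) (k : ℕ) :
    flightsMass βL βR l θ p (2 * k) = cycleMass βL βR l θ ^ k := by
  induction k with
  | zero => rw [mul_zero, pow_zero, flightsMass_zero hL hR]
  | succ k ih =>
    rw [mul_add_one, flightsMass_succ hL hR, flightsMass_succ hL hR, ← mul_assoc,
      flightMass_mul_flightMass_neg hL hR l θ hp, neg_neg, ih, pow_succ']

theorem tsum_flightsMass_ne_top (hL : 0 < βL) (hR : 0 < βR) {l θ p : ℝ} (hp : p ≠ 0)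
    (h : cycleMass βL βR l θ < 1) : ∑' n, flightsMass βL βR l θ p n ≠ ⊤ := by
  have hgeom : ∑' k : ℕ, cycleMass βL βR l θ ^ k ≠ ⊤ := by
    rw [ENNReal.tsum_geometric]
    exact ENNReal.inv_ne_top.2 (tsub_pos_of_lt h).ne'
  have hfin : flightMass βL βR l θ p ≠ ⊤ := fun htop => by
    rw [← flightMass_mul_flightMass_neg hL hR l θ hp, htop,
      ENNReal.top_mul (flightMass_pos hL hR l θ (neg_ne_zero.2 hp)).ne'] at h
    exact not_top_lt h
  rw [← tsum_even_add_odd ENNReal.summable ENNReal.summable]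
  simp only [flightsMass_succ hL hR, flightsMass_two_mul hL hR l θ hp,
    flightsMass_two_mul hL hR l θ (neg_ne_zero.2 hp), ENNReal.tsum_mul_left]
  exact ENNReal.add_ne_top.2 ⟨hgeom, ENNReal.mul_ne_top hfin hgeom⟩

theorem ae_exists_lt_flightTime (hL : 0 < βL) (hR : 0 < βR) {p : ℝ} (hp : p ≠ 0) :
    ∀ᵐ u ∂speedLaw βL βR p, ∀ t : ℝ, ∃ n, t < flightTime n u := by
  have hle : cycleMass βL βR 0 0 ≤ 1 := zero_mem_epigraph hL hR
  have hlt : cycleMass βL βR 0 1 < 1 := by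
    have hdom : ((0 : ℝ), (1 : ℝ)) ∈ cycleDomain βL βR :=
      ⟨(zero_mem_cycleDomain hL hR).1, zero_le_one' ℝ⟩
    have hfin : cycleMass βL βR 0 1 ≠ ⊤ := cycleMass_ne_top_of_mem_cycleDomain hL hR hdom
    exact (cycleMass_strictAnti hL hR zero_lt_one hfin).trans_le hle
  have hsum : ∫⁻ u, ∑' n, flightsWeight 0 1 p n u ∂speedLaw βL βR p ≠ ⊤ := by
    rw [lintegral_tsum fun n => Measurable.aemeasurable (by fun_prop)]
    exact tsum_flightsMass_ne_top hL hR hp hlt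
  filter_upwards [ae_lt_top (Measurable.tsum fun n => by fun_prop) hsum] with u hu t
  obtain ⟨n, hn⟩ := ((ENNReal.tendsto_atTop_zero_of_tsum_ne_top hu.ne).eventually
    (gt_mem_nhds (ENNReal.ofReal_pos.2 (Real.exp_pos (-t))))).exists
  rw [flightsWeight, ENNReal.ofReal_lt_ofReal_iff (Real.exp_pos _), Real.exp_lt_exp] at hn
  exact ⟨n, by linarith⟩

end Flights

section Current

/-- The time of the first collision, at which the particle leaves the wall for the first time. -/
def firstCollisionTime (q₀ p₀ : ℝ) : ℝ := ((Real.sign p₀ + 1) / 2 - q₀) / p₀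

theorem collisionTime_eq_add_flightTime (q₀ p₀ : ℝ) (u : ℕ → ℝ) (k : ℕ) :
    collisionTime q₀ p₀ u k = firstCollisionTime q₀ p₀ + flightTime k u := rfl

/-- The event that a particle leaving the wall at time `0` completes exactly `n` flights by
time `t`. -/
def flightCountEvent (t : ℝ) (n : ℕ) : Set (ℕ → ℝ) :=
  {u | flightTime n u ≤ t ∧ t < flightTime (n + 1) u}

/-- The exponential `e^{λ J[0,t]}` for a particle leaving the wall at time `0`, restricted to the
event that exactly `n` flights are completed by time `t`. -/
def currentWeight (l p t : ℝ) (n : ℕ) : (ℕ → ℝ) → ENNReal :=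
  (flightCountEvent t n).indicator (flightsWeight l 0 p n)

@[fun_prop]
theorem measurable_currentWeight (l p t : ℝ) (n : ℕ) : Measurable (currentWeight l p t n) :=
  (measurable_flightsWeight l 0 p n).indicator
    ((measurableSet_le (measurable_flightTime n) measurable_const).inter
      (measurableSet_lt measurable_const (measurable_flightTime (n + 1))))

/-- The exponential moment `E e^{λ J[0,t]}` of a particle leaving the wall at time `0`. -/
def wallMgf (βL βR l p t : ℝ) : ENNReal := ∫⁻ u, ∑' n, currentWeight l p t n u ∂speedLaw βL βR p

theorem monotone_flightTime {u : ℕ → ℝ} (hu : ∀ k, 0 < u k) :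
    Monotone fun n => flightTime n u := by
  refine monotone_nat_of_le_succ fun n => ?_
  rw [flightTime, flightTime, Finset.sum_range_succ]
  exact le_add_of_nonneg_right (one_div_pos.2 (hu n)).le

theorem exists_forall_le_iff_le {f : ℕ → ℝ} (hf : Monotone f) {s : ℝ} (hzero : f 0 ≤ s)
    (hlt : ∃ n, s < f n) : ∃ m, ∀ n, f n ≤ s ↔ n ≤ m := by
  classical
  have hspec := Nat.find_spec hlt
  obtain ⟨m, hm⟩ : ∃ m, Nat.find hlt = m + 1 := Nat.exists_eq_succ_of_ne_zero fun h => by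
    rw [h] at hspec
    exact hspec.not_ge hzero
  rw [hm] at hspec
  refine ⟨m, fun n => ⟨fun hn => ?_, fun hn => not_lt.1 (Nat.find_min hlt (by omega))⟩⟩
  by_contra! hmn
  exact hspec.not_ge ((hf hmn).trans hn)

theorem current_eq_flightEnergy {q₀ p₀ t : ℝ} (hp : p₀ ≠ 0) {u : ℕ → ℝ} {m : ℕ}
    (hm : ∀ n, flightTime n u ≤ t - firstCollisionTime q₀ p₀ ↔ n ≤ m) :
    current q₀ p₀ u t = flightEnergy p₀ m u := by
  have hle (k : ℕ) : collisionTime q₀ p₀ u (k + 1) ≤ t ↔ k ∈ Finset.range m := by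
    rw [collisionTime_eq_add_flightTime, ← le_sub_iff_add_le', hm, Nat.succ_le_iff,
      Finset.mem_range]
  rw [current, flightEnergy, tsum_eq_sum fun k hk => if_neg (hle k |>.not.2 hk)]
  congr 1
  refine Finset.sum_congr rfl fun k hk => ?_
  rw [if_pos ((hle k).2 hk), mul_pow, wallSign_sq hp, one_mul]

theorem tsum_currentWeight_eq {l p t : ℝ} {u : ℕ → ℝ} {m : ℕ}
    (hm : ∀ n, flightTime n u ≤ t ↔ n ≤ m) :
    ∑' n, currentWeight l p t n u = ENNReal.ofReal (Real.exp (l * flightEnergy p m u)) := by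
  have hmem (n : ℕ) : u ∈ flightCountEvent t n ↔ n = m := by
    change (flightTime n u ≤ t ∧ t < flightTime (n + 1) u) ↔ n = m
    rw [hm, ← not_le, hm]
    omega
  have hzero (n : ℕ) (hn : n ≠ m) : currentWeight l p t n u = 0 :=
    Set.indicator_of_notMem (fun hu => hn ((hmem n).1 hu)) _
  rw [tsum_eq_single m hzero, currentWeight, Set.indicator_of_mem ((hmem m).2 rfl), flightsWeight,
    zero_mul, sub_zero]

theorem lintegral_exp_current (hL : 0 < βL) (hR : 0 < βR) {q₀ p₀ l t : ℝ} (hp : p₀ ≠ 0)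
    (ht : firstCollisionTime q₀ p₀ ≤ t) :
    ∫⁻ u, ENNReal.ofReal (Real.exp (l * current q₀ p₀ u t)) ∂speedLaw βL βR p₀ =
      wallMgf βL βR l p₀ (t - firstCollisionTime q₀ p₀) := by
  refine lintegral_congr_ae ?_
  filter_upwards [ae_pos_speedLaw hL hR p₀, ae_exists_lt_flightTime hL hR hp] with u hpos hdiv
  obtain ⟨m, hm⟩ := exists_forall_le_iff_le (monotone_flightTime hpos)
    ((flightTime_zero u).trans_le (sub_nonneg.2 ht)) (hdiv _)
  rw [current_eq_flightEnergy hp hm, tsum_currentWeight_eq hm]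

theorem exists_wallMgf_le (hL : 0 < βL) (hR : 0 < βR) {l θ p : ℝ} (hp : p ≠ 0)
    (h : cycleMass βL βR l θ < 1) :
    ∃ C : ENNReal, C ≠ ⊤ ∧ ∀ t, wallMgf βL βR l p t ≤ C * ENNReal.ofReal (Real.exp (θ * t)) := by
  have hθ : 0 ≤ θ := (mem_cycleDomain_of_cycleMass_ne_top hL hR h.ne_top).2
  refine ⟨_, tsum_flightsMass_ne_top hL hR hp h, fun t => ?_⟩
  rw [wallMgf, lintegral_tsum fun n => Measurable.aemeasurable (by fun_prop),
    ← ENNReal.tsum_mul_right]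
  refine ENNReal.tsum_le_tsum fun n => ?_
  rw [flightsMass, ← lintegral_mul_const _ (by fun_prop)]
  refine lintegral_mono (Set.indicator_le fun u hu => ?_)
  rw [flightsWeight, flightsWeight, ← ENNReal.ofReal_mul (Real.exp_pos _).le, ← Real.exp_add]
  have := mul_le_mul_of_nonneg_left hu.1 hθ
  exact ENNReal.ofReal_le_ofReal (Real.exp_le_exp.2 (by linarith))

end Current

section Renewal

theorem tsum_currentWeight_consSeq (l p t x : ℝ) (v : ℕ → ℝ) :
    ∑' n, currentWeight l p t n (consSeq x v) =
      {x : ℝ | 0 ≤ t ∧ t < 1 / x}.indicator 1 x +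
        flightWeight l 0 p x * ∑' n, currentWeight l (-p) (t - 1 / x) n v := by
  classical
  have hmem_zero : consSeq x v ∈ flightCountEvent t 0 ↔ 0 ≤ t ∧ t < 1 / x := by
    change flightTime 0 (consSeq x v) ≤ t ∧ t < flightTime 1 (consSeq x v) ↔ _
    rw [flightTime_consSeq, flightTime_zero, flightTime_zero, zero_add]
  have hmem_succ (n : ℕ) :
      consSeq x v ∈ flightCountEvent t (n + 1) ↔ v ∈ flightCountEvent (t - 1 / x) n := by
    change flightTime (n + 1) (consSeq x v) ≤ t ∧ t < flightTime (n + 2) (consSeq x v) ↔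
      flightTime n v ≤ t - 1 / x ∧ t - 1 / x < flightTime (n + 1) v
    rw [flightTime_consSeq, flightTime_consSeq, le_sub_iff_add_le, sub_lt_iff_lt_add]
  rw [tsum_eq_zero_add' ENNReal.summable, ← ENNReal.tsum_mul_left]
  simp only [currentWeight, Set.indicator_apply, hmem_zero, hmem_succ, flightsWeight_zero,
    flightsWeight_consSeq, mul_ite, mul_zero]
  rfl

theorem wallMgf_eq_add_lintegral (hL : 0 < βL) (hR : 0 < βR) (l p t : ℝ) :
    wallMgf βL βR l p t = emissionLaw βL βR p {x | 0 ≤ t ∧ t < 1 / x} +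
      ∫⁻ x, flightWeight l 0 p x * wallMgf βL βR l (-p) (t - 1 / x) ∂emissionLaw βL βR p := by
  have := isProbabilityMeasure_speedLaw hL hR (-p)
  have hmeas : MeasurableSet {x : ℝ | 0 ≤ t ∧ t < 1 / x} :=
    (MeasurableSet.const _).inter (measurableSet_lt measurable_const (measurable_id.const_div 1))
  rw [← lintegral_indicator_one hmeas, ← lintegral_add_left (measurable_one.indicator hmeas),
    wallMgf, lintegral_speedLaw hL hR p (Measurable.tsum fun n => by fun_prop)]
  refine lintegral_congr fun x => ?_
  simp only [tsum_currentWeight_consSeq]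
  rw [lintegral_add_left measurable_const, lintegral_const, measure_univ, mul_one,
    lintegral_const_mul _ (Measurable.tsum fun n => by fun_prop), wallMgf]

theorem exists_mul_exp_le_wallMgf_of_le (hL : 0 < βL) (hR : 0 < βR) (l θ p : ℝ) {m : ℝ}
    (hm : 0 < m) : ∃ w : ENNReal, w ≠ 0 ∧ ∀ t, 0 ≤ t → t ≤ m →
      w * ENNReal.ofReal (Real.exp (θ * t)) ≤ wallMgf βL βR l p t := by
  have hpos : emissionLaw βL βR p (Set.Ioo 0 (1 / m)) ≠ 0 :=
    (wallLaw_Ioo_pos (wallBeta_pos hL hR _) (one_div_pos.2 hm)).ne'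
  refine ⟨emissionLaw βL βR p (Set.Ioo 0 (1 / m)) * ENNReal.ofReal (Real.exp (-(|θ| * m))),
    mul_ne_zero hpos (ENNReal.ofReal_pos.2 (Real.exp_pos _)).ne', fun t ht₀ htm => ?_⟩
  have hθ : θ * t ≤ |θ| * m := mul_le_mul (le_abs_self θ) htm ht₀ (abs_nonneg θ)
  have hslow : Set.Ioo 0 (1 / m) ⊆ {x | 0 ≤ t ∧ t < 1 / x} := fun x hx =>
    ⟨ht₀, htm.trans_lt ((lt_one_div hm hx.1).2 hx.2)⟩
  calc _ ≤ emissionLaw βL βR p (Set.Ioo 0 (1 / m)) := by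
        rw [mul_assoc, ← ENNReal.ofReal_mul (Real.exp_pos _).le, ← Real.exp_add]
        refine mul_le_of_le_one_right' (ENNReal.ofReal_le_one.2 (Real.exp_le_one_iff.2 ?_))
        linarith
    _ ≤ emissionLaw βL βR p {x | 0 ≤ t ∧ t < 1 / x} := measure_mono hslow
    _ ≤ _ := (wallMgf_eq_add_lintegral hL hR l p t).symm ▸ le_self_add

/-- The exponential moment of one flight, restricted to speeds in `[1/m, m]`. -/
def truncatedFlightMass (βL βR l θ p m : ℝ) : ENNReal :=
  ∫⁻ x in Set.Icc m⁻¹ m, flightWeight l θ p x ∂emissionLaw βL βR p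

theorem truncatedFlightMass_ne_top (hL : 0 < βL) (hR : 0 < βR) (l θ p : ℝ) {m : ℝ} (hm : 0 < m) :
    truncatedFlightMass βL βR l θ p m ≠ ⊤ := by
  have := isProbabilityMeasure_emissionLaw hL hR p
  have hcont : ContinuousOn (fun x => Real.exp (l / 2 * (x ^ 2 * -Real.sign p) - θ * (1 / x)))
      (Set.Icc m⁻¹ m) := by
    have hne (x : ℝ) (hx : x ∈ Set.Icc m⁻¹ m) : x ≠ 0 := ((inv_pos.2 hm).trans_le hx.1).ne'
    fun_prop (disch := assumption)
  exact (hcont.integrableOn_compact isCompact_Icc).lintegral_lt_top.ne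

theorem tendsto_truncatedFlightMass (l θ p : ℝ) :
    Tendsto (truncatedFlightMass βL βR l θ p) atTop (𝓝 (flightMass βL βR l θ p)) := by
  have hcover : AECover (emissionLaw βL βR p) atTop fun m : ℝ => Set.Icc m⁻¹ m :=
    ⟨(ae_pos_wallLaw _).mono fun x hx => (tendsto_inv_atTop_zero.eventually_le_const hx).and
      (eventually_ge_atTop x), fun _ => measurableSet_Icc⟩
  exact hcover.lintegral_tendsto_of_countably_generated (by fun_prop)

theorem mul_truncatedFlightMass_le_wallMgf (hL : 0 < βL) (hR : 0 < βR) {l θ p m t : ℝ}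
    (hm : 0 < m) (ht : m ≤ t) {B : ENNReal}
    (hB : ∀ s, 0 ≤ s → s ≤ t - m⁻¹ →
      B * ENNReal.ofReal (Real.exp (θ * s)) ≤ wallMgf βL βR l (-p) s) :
    B * truncatedFlightMass βL βR l θ p m * ENNReal.ofReal (Real.exp (θ * t)) ≤
      wallMgf βL βR l p t := by
  have hweight (x : ℝ) : ENNReal.ofReal (Real.exp (θ * t)) * flightWeight l θ p x =
      flightWeight l 0 p x * ENNReal.ofReal (Real.exp (θ * (t - 1 / x))) := by
    rw [flightWeight, flightWeight, ← ENNReal.ofReal_mul (Real.exp_pos _).le,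
      ← ENNReal.ofReal_mul (Real.exp_pos _).le, ← Real.exp_add, ← Real.exp_add]
    ring_nf
  rw [wallMgf_eq_add_lintegral hL hR, mul_right_comm, truncatedFlightMass,
    ← lintegral_const_mul _ (by fun_prop)]
  refine le_add_left ((setLIntegral_mono' measurableSet_Icc fun x hx => ?_).trans
    (setLIntegral_le_lintegral (Set.Icc m⁻¹ m) _))
  have hpos : 0 < x := (inv_pos.2 hm).trans_le hx.1
  have hslow : 1 / x ≤ m := (one_div_le hpos hm).2 (one_div m ▸ hx.1)
  have hfast : m⁻¹ ≤ 1 / x := one_div x ▸ inv_anti₀ hpos hx.2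
  rw [mul_assoc, hweight, mul_left_comm]
  gcongr
  exact hB _ (by linarith) (by linarith)

theorem exists_one_lt_truncatedFlightMass_mul (hL : 0 < βL) (hR : 0 < βR) {l θ p : ℝ} (hp : p ≠ 0)
    (h : 1 < cycleMass βL βR l θ) : ∃ m, 0 < m ∧
      1 < truncatedFlightMass βL βR l θ p m * truncatedFlightMass βL βR l θ (-p) m := by
  rw [← flightMass_mul_flightMass_neg hL hR l θ hp] at h
  have hlim := ENNReal.Tendsto.mul (tendsto_truncatedFlightMass (βL := βL) (βR := βR) l θ p)
    (Or.inl (flightMass_pos hL hR l θ hp).ne')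
    (tendsto_truncatedFlightMass (βL := βL) (βR := βR) l θ (-p))
    (Or.inl (flightMass_pos hL hR l θ (neg_ne_zero.2 hp)).ne')
  exact ((eventually_gt_atTop 0).and (hlim.eventually (lt_mem_nhds h))).exists

theorem forall_nonneg_of_delay {P : ℝ → Prop} {δ : ℝ} (hδ : 0 < δ)
    (hP : ∀ t, 0 ≤ t → (∀ s, 0 ≤ s → s ≤ t - δ → P s) → P t) (t : ℝ) (ht : 0 ≤ t) : P t := by
  have hbounded (k : ℕ) : ∀ t, 0 ≤ t → t < k * δ → P t := by
    induction k with
    | zero => exact fun t ht hlt => absurd hlt (by simpa using ht)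
    | succ k ih =>
      intro t ht hlt
      push_cast at hlt
      exact hP t ht fun s hs hst => ih s hs (by linarith)
  obtain ⟨k, hk⟩ := exists_nat_gt (t / δ)
  exact hbounded k t ht ((div_lt_iff₀ hδ).1 hk)

/- A long history decomposes into its first flight and the rest. Both walls are treated at once: the
rates `x` and `y` of growth over one flight from either wall satisfy `1 < x * y`, so the bounds
`c x e^{θt}` and `c e^{θt}` reproduce themselves. -/
theorem exists_mul_exp_le_wallMgf (hL : 0 < βL) (hR : 0 < βR) {l θ p : ℝ} (hp : p ≠ 0)
    (h : 1 < cycleMass βL βR l θ) :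
    ∃ c : ENNReal, c ≠ 0 ∧ ∀ t, 0 ≤ t →
      c * ENNReal.ofReal (Real.exp (θ * t)) ≤ wallMgf βL βR l p t := by
  obtain ⟨m, hm, hxy⟩ := exists_one_lt_truncatedFlightMass_mul hL hR hp h
  obtain ⟨w, hw, hshort⟩ := exists_mul_exp_le_wallMgf_of_le hL hR l θ p hm
  obtain ⟨w', hw', hshort'⟩ := exists_mul_exp_le_wallMgf_of_le hL hR l θ (-p) hm
  set x := truncatedFlightMass βL βR l θ p m
  set y := truncatedFlightMass βL βR l θ (-p) m
  have hx : x ≠ 0 := left_ne_zero_of_mul (zero_lt_one.trans hxy).ne'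
  obtain ⟨c, hc, hcx, hcw'⟩ : ∃ c : ENNReal, c ≠ 0 ∧ c * x ≤ w ∧ c ≤ w' :=
    ⟨min (w / x) w',
      (lt_min (ENNReal.div_pos hw (truncatedFlightMass_ne_top hL hR l θ p hm))
        (pos_iff_ne_zero.2 hw')).ne',
      ENNReal.mul_le_of_le_div (min_le_left _ _), min_le_right _ _⟩
  have hboth := forall_nonneg_of_delay (inv_pos.2 hm)
    (P := fun t => c * x * ENNReal.ofReal (Real.exp (θ * t)) ≤ wallMgf βL βR l p t ∧
      c * ENNReal.ofReal (Real.exp (θ * t)) ≤ wallMgf βL βR l (-p) t) fun t ht ih => by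
    rcases le_total t m with htm | htm
    · exact ⟨(mul_le_mul_left hcx _).trans (hshort t ht htm),
        (mul_le_mul_left hcw' _).trans (hshort' t ht htm)⟩
    · have hgrow := mul_truncatedFlightMass_le_wallMgf hL hR (p := -p) hm htm
        fun s hs hst => (neg_neg p).symm ▸ (ih s hs hst).1
      refine ⟨mul_truncatedFlightMass_le_wallMgf hL hR hm htm fun s hs hst => (ih s hs hst).2,
        le_trans ?_ hgrow⟩
      rw [mul_assoc c]
      gcongr
      exact le_mul_of_one_le_right' hxy.le
  exact ⟨c * x, mul_ne_zero hc hx, fun t ht => (hboth t ht).1⟩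

end Renewal

section Limit

theorem tendsto_one_div_mul_log_mul_exp {c : ENNReal} (hc : c ≠ 0) (hc' : c ≠ ⊤) (b θ : ℝ) :
    Tendsto (fun t : ℝ => ((1 / t : ℝ) : EReal) *
      ENNReal.log (c * ENNReal.ofReal (Real.exp (θ * (t - b))))) atTop (𝓝 (θ : EReal)) := by
  have hpos : 0 < c.toReal := ENNReal.toReal_pos hc hc'
  have hlim : Tendsto (fun t : ℝ => t⁻¹ * (Real.log c.toReal - θ * b) + θ) atTop (𝓝 θ) := by
    simpa using (tendsto_inv_atTop_zero.mul_const (Real.log c.toReal - θ * b)).add_const θ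
  refine (EReal.tendsto_coe.2 hlim).congr' ?_
  filter_upwards [eventually_ne_atTop 0] with t ht
  rw [← ENNReal.ofReal_toReal hc', ← ENNReal.ofReal_mul hpos.le,
    ENNReal.log_ofReal_of_pos (by positivity), Real.log_mul hpos.ne' (Real.exp_pos _).ne',
    Real.log_exp, ← EReal.coe_mul, ENNReal.toReal_ofReal hpos.le]
  congr 1
  field_simp
  ring

theorem eventually_lt_scaledLogMgf (hL : 0 < βL) (hR : 0 < βR) {l θ p₀ : ℝ} (q₀ : ℝ)
    (hp : p₀ ≠ 0) (h : 1 < cycleMass βL βR l θ) {a : EReal} (ha : a < θ) :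
    ∀ᶠ t in atTop, a < scaledLogMgf βL βR q₀ p₀ l t := by
  obtain ⟨c, hc, hmgf⟩ := exists_mul_exp_le_wallMgf hL hR hp h
  have hlim := tendsto_one_div_mul_log_mul_exp (c := min c 1)
    (lt_min (pos_iff_ne_zero.2 hc) one_pos).ne' (min_lt_of_right_lt ENNReal.one_lt_top).ne
    (firstCollisionTime q₀ p₀) θ
  filter_upwards [hlim.eventually (lt_mem_nhds ha), eventually_ge_atTop 0,
    eventually_ge_atTop (firstCollisionTime q₀ p₀)] with t hlt ht₀ ht
  rw [scaledLogMgf, lintegral_exp_current hL hR hp ht]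
  refine hlt.trans_le (mul_le_mul_of_nonneg_left (ENNReal.log_monotone ?_)
    (EReal.coe_nonneg.2 (one_div_nonneg.2 ht₀)))
  exact (mul_le_mul_left (min_le_left _ _) _).trans (hmgf _ (sub_nonneg.2 ht))

theorem eventually_scaledLogMgf_lt (hL : 0 < βL) (hR : 0 < βR) {l θ p₀ : ℝ} (q₀ : ℝ)
    (hp : p₀ ≠ 0) (h : cycleMass βL βR l θ < 1) {a : EReal} (ha : θ < a) :
    ∀ᶠ t in atTop, scaledLogMgf βL βR q₀ p₀ l t < a := by
  obtain ⟨c, hc, hmgf⟩ := exists_wallMgf_le hL hR hp h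
  have hlim := tendsto_one_div_mul_log_mul_exp (c := max c 1)
    (lt_max_of_lt_right one_pos).ne' (max_lt hc.lt_top ENNReal.one_lt_top).ne
    (firstCollisionTime q₀ p₀) θ
  filter_upwards [hlim.eventually (gt_mem_nhds ha), eventually_ge_atTop 0,
    eventually_ge_atTop (firstCollisionTime q₀ p₀)] with t hlt ht₀ ht
  rw [scaledLogMgf, lintegral_exp_current hL hR hp ht]
  refine (mul_le_mul_of_nonneg_left (ENNReal.log_monotone ?_)
    (EReal.coe_nonneg.2 (one_div_nonneg.2 ht₀))).trans_lt hlt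
  exact (hmgf _).trans (mul_le_mul_left (le_max_left _ _) _)

/-- The function of `λ` whose epigraph is `epigraph βL βR`. -/
def lowerEnvelope (βL βR l : ℝ) : EReal := ⨅ (r : ℝ) (_ : (l, r) ∈ epigraph βL βR), (r : EReal)

theorem lowerEnvelope_le_iff (hL : 0 < βL) (hR : 0 < βR) {l θ : ℝ} :
    lowerEnvelope βL βR l ≤ θ ↔ (l, θ) ∈ epigraph βL βR := by
  refine ⟨fun h => ?_, fun h => iInf₂_le θ h⟩
  have hsub : Set.Ioi θ ⊆ (fun r => (l, r)) ⁻¹' epigraph βL βR := fun r hr => by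
    have hlt := h.trans_lt (EReal.coe_lt_coe_iff.2 hr)
    simp only [lowerEnvelope, iInf_lt_iff] at hlt
    obtain ⟨r', hr', hlt⟩ := hlt
    exact mem_epigraph_of_le hL hR hr' (EReal.coe_lt_coe_iff.1 hlt).le
  have hclosed : IsClosed ((fun r => (l, r)) ⁻¹' epigraph βL βR) :=
    isClosed_epigraph.preimage (by fun_prop)
  exact closure_minimal hsub hclosed (closure_Ioi θ ▸ Set.self_mem_Ici)

theorem lowerEnvelope_nonneg (hL : 0 < βL) (hR : 0 < βR) (l : ℝ) : 0 ≤ lowerEnvelope βL βR l :=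
  le_iInf₂ fun _ hr => EReal.coe_nonneg.2 (epigraph_subset_cycleDomain hL hR hr).2

theorem tendsto_scaledLogMgf (hL : 0 < βL) (hR : 0 < βR) (q₀ : ℝ) {p₀ : ℝ} (hp : p₀ ≠ 0) (l : ℝ) :
    Tendsto (scaledLogMgf βL βR q₀ p₀ l) atTop (𝓝 (lowerEnvelope βL βR l)) := by
  refine tendsto_order.2 ⟨fun a ha => ?_, fun b hb => ?_⟩
  · obtain ⟨r, har, hr⟩ := EReal.lt_iff_exists_real_btwn.1 ha
    have hmass : 1 < cycleMass βL βR l r :=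
      not_le.1 fun h => hr.not_ge ((lowerEnvelope_le_iff hL hR).2 h)
    exact eventually_lt_scaledLogMgf hL hR q₀ hp hmass har
  · obtain ⟨r', hr', hrb'⟩ := EReal.lt_iff_exists_real_btwn.1 hb
    obtain ⟨r, hr, hrb⟩ := EReal.lt_iff_exists_real_btwn.1 hrb'
    have hmem := (lowerEnvelope_le_iff hL hR).1 hr'.le
    have hlt : r' < r := EReal.coe_lt_coe_iff.1 hr
    have hmem' : (l, r) ∈ epigraph βL βR := mem_epigraph_of_le hL hR hmem hlt.le
    have hmass : cycleMass βL βR l r < 1 :=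
      (cycleMass_strictAnti hL hR hlt (ne_top_of_le_ne_top ENNReal.one_ne_top hmem')).trans_le hmem
    exact eventually_scaledLogMgf_lt hL hR q₀ hp hmass hrb

theorem cgf_eq_lowerEnvelope (hL : 0 < βL) (hR : 0 < βR) (q₀ : ℝ) {p₀ : ℝ} (hp : p₀ ≠ 0) (l : ℝ) :
    cgf βL βR q₀ p₀ l = lowerEnvelope βL βR l :=
  (tendsto_scaledLogMgf hL hR q₀ hp l).limsup_eq

theorem rateFunction_eq_rate (hL : 0 < βL) (hR : 0 < βR) (q₀ : ℝ) {p₀ : ℝ} (hp : p₀ ≠ 0) (j : ℝ) :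
    rateFunction βL βR q₀ p₀ j = (rate βL βR j : EReal) := by
  simp only [rateFunction, cgf_eq_lowerEnvelope hL hR q₀ hp]
  refine le_antisymm (iSup_le fun l => ?_) ?_
  · have hnonneg := lowerEnvelope_nonneg hL hR l
    induction hl : lowerEnvelope βL βR l with
    | bot => simp [hl] at hnonneg
    | top => simp
    | coe r => exact_mod_cast le_rate hL hR ((lowerEnvelope_le_iff hL hR).1 hl.le) j
  · obtain ⟨q, hq, hmax⟩ := exists_isMaxOn_epigraph hL hR j
    rw [rate_eq_of_isMaxOn hq hmax, EReal.coe_sub]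
    exact (EReal.sub_le_sub le_rfl ((lowerEnvelope_le_iff hL hR).2 hq)).trans
      (le_iSup (fun l : ℝ => ((l * j : ℝ) : EReal) - lowerEnvelope βL βR l) q.1)

end Limit

end

end ConfinedTracer

open ConfinedTracer in
theorem mainTheorem4 (βL βR : ℝ) (hL : 0 < βL) (hLR : βL ≤ βR)
    (q₀ p₀ : ℝ) (hq₀ : q₀ ∈ Set.Icc (0 : ℝ) 1) (hp₀ : p₀ ≠ 0) :
    -- the limit defining the cumulant generating function exists in the extended reals, and
    -- it does not depend on the initial data
    (∀ l : ℝ, Tendsto (scaledLogMgf βL βR q₀ p₀ l) atTop (𝓝 (cgf βL βR q₀ p₀ l))) ∧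
    (∀ q₁ ∈ Set.Icc (0 : ℝ) 1, ∀ p₁ : ℝ, p₁ ≠ 0 →
      ∀ l : ℝ, cgf βL βR q₁ p₁ l = cgf βL βR q₀ p₀ l) ∧
    -- the Legendre transform is finite, that is, given by a real-valued function
    ∃ I : ℝ → ℝ, (∀ j : ℝ, rateFunction βL βR q₀ p₀ j = (I j : EReal)) ∧
      (∀ j : ℝ, 0 ≤ I j) ∧
      ConvexOn ℝ Set.univ I ∧
      -- smooth and strictly convex outside `[-j*, j*]`
      ContDiffOn ℝ (⊤ : ℕ∞) I (Set.Icc (-jStar βL βR) (jStar βL βR))ᶜ ∧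
      (∀ x ∈ (Set.Icc (-jStar βL βR) (jStar βL βR))ᶜ,
        ∀ y ∈ (Set.Icc (-jStar βL βR) (jStar βL βR))ᶜ, x ≠ y →
        ∀ a b : ℝ, 0 < a → 0 < b → a + b = 1 → I (a * x + b * y) < a * I x + b * I y) ∧
      (∀ j ∈ Set.Icc 0 (jStar βL βR), I j = 0) ∧
      (∀ j ∈ Set.Icc (-jStar βL βR) 0, I j = (βR - βL) * |j|) ∧
      (∀ j : ℝ, I j = (βL - βR) * j + I (-j)) := by
  have hR := hL.trans_le hLR
  refine ⟨fun l => ?_, fun q₁ _ p₁ hp₁ l => ?_, rate βL βR, rateFunction_eq_rate hL hR q₀ hp₀,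
    rate_nonneg hL hR, convexOn_rate hL hR, contDiffOn_rate hL hLR,
    fun x hx y hy hxy a b ha hb hab => rate_lt hL hLR hxy hx hy ha hb hab,
    fun j hj => rate_eq_zero hL hR hj, fun j hj => ?_, rate_reflect hL hR⟩
  · rw [cgf_eq_lowerEnvelope hL hR q₀ hp₀]
    exact tendsto_scaledLogMgf hL hR q₀ hp₀ l
  · rw [cgf_eq_lowerEnvelope hL hR q₁ hp₁, cgf_eq_lowerEnvelope hL hR q₀ hp₀]
  · rw [rate_reflect hL hR j, rate_eq_zero hL hR (j := -j) ⟨by linarith [hj.2], by linarith [hj.1]⟩,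
      abs_of_nonpos hj.2]
    ring
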